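/- Let $\ell>0$, let $L^2=L^2((0,\ell))$ be the complex Hilbert space of square integrable functions, and for $m\in\mathbb{N}_0$ let $W^m=W^m((0,\ell))$ be the Sobolev space of all $\xi\in L^2$ whose distributional derivatives $\xi^{(s)}$, $0\le s\le m$, lie in $L^2$. A support of one end $x^\star\in\{0,\ell\}$ is one of the following pairs of boundary conditions: (a) $\xi(x^\star)=\xi''(x^\star)=0$; (b) $\xi(x^\star)=\xi'(x^\star)=0$; (c) $\xi''(x^\star)=\xi'''(x^\star)=0$. A support case is either one of the nine combinations (p)--(q) of a support (p) at $x=0$ with a support (q) at $x=\ell$, $p,q\in\{a,b,c\}$, or one of - add-(i): $\xi'(0)=\xi'(\ell)=\xi'''(0)=\xi'''(\ell)=0$; - add-(ii): $\xi(0)=\xi'(\ell)=\xi''(0)=\xi'''(\ell)=0$; - add-(iii): $\xi(\ell)=\xi'(0)=\xi''(\ell)=\xi'''(0)=0$. Write $\delta_{\pm\pm}$ for the operator $\xi\mapsto\xi'$ in $L^2$ on the set of $\xi\in W^1$ with $\xi(0)=0$ if the first index is $+$ and $\xi(\ell)=0$ if the second index is $+$ (no condition at an end with index $-$). For a given support case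 let $\hat A=\delta_3\delta_2\delta_1\delta_0$ (operator product with its natural domain), where $\delta_k$ is the operator $\delta_{\pm\pm}$ whose first (second) index is $+$ exactly if $\xi^{(k)}(0)=0$ (respectively $\xi^{(k)}(\ell)=0$) is among the four boundary conditions. Thus $\hat A\xi=\xi''''$ on the set of all $\xi\in W^4$ that satisfy the four boundary conditions. Let $A\supseteq\hat A$ be the positive selfadjoint extension in $L^2$ whose domain is contained in the set of those $\xi\in W^2$ that satisfy the boundary conditions of the support case on $\xi$ and $\xi'$ (that is, let $A$ be any operator with these properties). Then for every support case: (a) $A$ has pure point (purely discrete) spectrum: $\sigma(A)=\sigma_p(A)\subset[0,\infty)$, and $L^2$ has an orthonormal basis $(\psi_n)_{n\in\mathbb{N}}$ of eigenvectors, $A\psi_n=a_n\psi_n$. (b) Each eigenspace is finite dimensional, and the basis can be chosen such that $0\le a_1\le a_2\le a_3\le\dots$, where the $a_n$ run through all eigenvalues, each repeated according to its finite multiplicity, and $\lim_{n\to\infty}a_n=\infty$. (c) $A$ has the eigenvalue $0$ if and only if the support case is (a)--(c), (c)--(a), (c)--(c) or add-(i). The eigenspace for the eigenvalue $0$ is one-dimensional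 for (a)--(c), spanned by $x$, for (c)--(a), spanned by $\ell-x$, and for add-(i), spanned by the constant function $1$; it is two-dimensional for (c)--(c), spanned by $1$ and $x$. -/

import Mathlib

open MeasureTheory Filter Topology
open scoped ComplexOrder ContDiff ComplexConjugate

noncomputable section

namespace Beam

/-! ### Unbounded operators: product, eigenspaces, spectrum -/

section Operators

variable {H : Type*} [NormedAddCommGroup H] [NormedSpace ℂ H]

/-- The operator product `B C`, with domain `{ξ ∈ dom C | C ξ ∈ dom B}` and `(B C) ξ = B (C ξ)`. -/
def opProd (B C : H →ₗ.[ℂ] H) : H →ₗ.[ℂ] H :=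
  B.comp (C.domRestrict ((B.domain.comap C.toFun).map C.domain.subtype)) (by
    rintro ⟨x, hx1, hx2⟩
    obtain ⟨y, hy, rfl⟩ := hx1
    exact hy)

theorem mem_graph_opProd (B C : H →ₗ.[ℂ] H) (x z : H) :
    (x, z) ∈ (opProd B C).graph ↔ ∃ y, (x, y) ∈ C.graph ∧ (y, z) ∈ B.graph := by
  simp only [LinearPMap.mem_graph_iff]
  constructor
  · rintro ⟨⟨w, hw1, hw2⟩, rfl, rfl⟩
    obtain ⟨v, hv, rfl⟩ := hw1
    refine ⟨C v, ⟨v, rfl, rfl⟩, ⟨⟨C v, hv⟩, rfl, ?_⟩⟩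
    rfl
  · rintro ⟨y, ⟨v, rfl, rfl⟩, ⟨w, hw, rfl⟩⟩
    have hv : v ∈ B.domain.comap C.toFun := by
      change C v ∈ B.domain
      rw [← hw]; exact w.2
    refine ⟨⟨v, ⟨v, hv, rfl⟩, v.2⟩, rfl, ?_⟩
    change B ⟨C v, _⟩ = B w
    congr 1
    exact Subtype.ext hw.symm

/-- The eigenspace `{ξ ∈ dom A | A ξ = z ξ}`; it is `0` when `z` is not an eigenvalue. -/
def eigenspace (A : H →ₗ.[ℂ] H) (z : ℂ) : Submodule ℂ H :=
  (LinearMap.ker (A.toFun - z • A.domain.subtype)).map A.domain.subtype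

theorem mem_eigenspace (A : H →ₗ.[ℂ] H) (z : ℂ) (x : H) :
    x ∈ eigenspace A z ↔ ∃ hx : x ∈ A.domain, A ⟨x, hx⟩ = z • x := by
  simp [eigenspace, sub_eq_zero]

/-- The point spectrum `σ_p(A)`: the set of eigenvalues. -/
def pointSpectrum (A : H →ₗ.[ℂ] H) : Set ℂ := {z | eigenspace A z ≠ ⊥}

/-- The resolvent set: those `z` for which `A - z : dom A → H` is bijective with an inverse that
is bounded (everywhere defined and continuous). -/
def resolventSet (A : H →ₗ.[ℂ] H) : Set ℂ :=
  {z | ∃ R : H →L[ℂ] H,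
    (∀ y, ∃ h : R y ∈ A.domain, A ⟨R y, h⟩ - z • R y = y) ∧
    ∀ x : A.domain, R (A x - z • (x : H)) = x}

/-- The spectrum `σ(A)`. -/
def spectrum (A : H →ₗ.[ℂ] H) : Set ℂ := (resolventSet A)ᶜ

end Operators

/-! ### Distributional derivatives in `L²((0,ℓ))` -/

/-- Lebesgue measure on the open interval `(0,ℓ)`. -/
abbrev μ (ℓ : ℝ) : Measure ℝ := volume.restrict (Set.Ioo 0 ℓ)

/-- The complex Hilbert space `L²((0,ℓ))`. -/
abbrev L2 (ℓ : ℝ) : Type := Lp ℂ 2 (μ ℓ)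

/-- `φ ∈ C_c^∞((0,ℓ))`. -/
def IsTestFunction (ℓ : ℝ) (φ : ℝ → ℂ) : Prop :=
  ContDiff ℝ ∞ φ ∧ HasCompactSupport φ ∧ tsupport φ ⊆ Set.Ioo 0 ℓ

/-- `η` is the square integrable distributional `s`-th derivative of `ξ`. -/
def HasWeakDeriv (ℓ : ℝ) (s : ℕ) (ξ η : L2 ℓ) : Prop :=
  ∀ φ : ℝ → ℂ, IsTestFunction ℓ φ →
    ∫ x in Set.Ioo 0 ℓ, conj (η x) * φ x =
      (-1) ^ s * ∫ x in Set.Ioo 0 ℓ, conj (ξ x) * iteratedDeriv s φ x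

/-- The Sobolev space `W^m((0,ℓ))`, as a subset of `L²`. -/
def W (ℓ : ℝ) (m : ℕ) : Set (L2 ℓ) := {ξ | ∀ s ≤ m, ∃ η, HasWeakDeriv ℓ s ξ η}

/-- The boundary value of `ξ` at the end point `x` exists and is zero: `ξ` has a representative that
is continuous on `[0,ℓ]` and vanishes at `x`. (That representative is unique on `[0,ℓ]`, and exists
for every `ξ ∈ W¹`.) -/
def VanishesAt (ℓ : ℝ) (ξ : L2 ℓ) (x : ℝ) : Prop :=
  ∃ g : ℝ → ℂ, ContinuousOn g (Set.Icc 0 ℓ) ∧ ξ =ᵐ[μ ℓ] g ∧ g x = 0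

/-- The boundary condition `ξ^(k)(x) = 0`. -/
def DerivVanishesAt (ℓ : ℝ) (k : ℕ) (ξ : L2 ℓ) (x : ℝ) : Prop :=
  ∃ η, HasWeakDeriv ℓ k ξ η ∧ VanishesAt ℓ η x

theorem VanishesAt.zero (ℓ x : ℝ) : VanishesAt ℓ 0 x :=
  ⟨0, continuousOn_const, Lp.coeFn_zero _ _ _, rfl⟩

theorem VanishesAt.add {ℓ x : ℝ} {ξ η : L2 ℓ} (h1 : VanishesAt ℓ ξ x) (h2 : VanishesAt ℓ η x) :
    VanishesAt ℓ (ξ + η) x := by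
  obtain ⟨f, hf, hf', hfx⟩ := h1
  obtain ⟨g, hg, hg', hgx⟩ := h2
  exact ⟨f + g, hf.add hg, (Lp.coeFn_add _ _).trans (hf'.add hg'), by simp [hfx, hgx]⟩

theorem VanishesAt.smul {ℓ x : ℝ} {ξ : L2 ℓ} (c : ℂ) (h : VanishesAt ℓ ξ x) :
    VanishesAt ℓ (c • ξ) x := by
  obtain ⟨f, hf, hf', hfx⟩ := h
  exact ⟨c • f, hf.const_smul c, (Lp.coeFn_smul _ _).trans (hf'.const_smul c), by simp [hfx]⟩

theorem IsTestFunction.iteratedDeriv {ℓ : ℝ} {φ : ℝ → ℂ} (h : IsTestFunction ℓ φ) (s : ℕ) :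
    IsTestFunction ℓ (iteratedDeriv s φ) := by
  have hs : tsupport (_root_.iteratedDeriv s φ) ⊆ tsupport φ := by
    induction s with
    | zero => simp
    | succ s ih =>
      rw [iteratedDeriv_succ]
      exact (closure_minimal (support_deriv_subset) (isClosed_tsupport _)).trans ih
  refine ⟨?_, ?_, hs.trans h.2.2⟩
  · rw [iteratedDeriv_eq_iterate]
    exact h.1.iterate_deriv s
  · exact h.2.1.of_isClosed_subset (isClosed_tsupport _) hs

theorem integrable_mul_test {ℓ : ℝ} (ξ : L2 ℓ) {φ : ℝ → ℂ} (h : IsTestFunction ℓ φ) :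
    Integrable (fun x => conj (ξ x) * φ x) (μ ℓ) := by
  have h1 : MemLp (fun x => conj (ξ x)) 2 (μ ℓ) := (Lp.memLp ξ).star
  have h2 : MemLp φ 2 (μ ℓ) :=
    (h.1.continuous.memLp_of_hasCompactSupport h.2.1 (μ := volume)).restrict _
  exact h1.integrable_mul h2

theorem HasWeakDeriv.zero (ℓ : ℝ) (s : ℕ) : HasWeakDeriv ℓ s 0 0 := by
  intro φ hφ
  have h0 : ∀ f : ℝ → ℂ, ∫ x in Set.Ioo 0 ℓ, conj ((0 : L2 ℓ) x) * f x = 0 := by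
    intro f
    rw [integral_congr_ae (g := fun _ => (0 : ℂ))]
    · simp
    · filter_upwards [Lp.coeFn_zero ℂ 2 (μ ℓ)] with x hx
      rw [hx]
      simp
  rw [h0, h0, mul_zero]

theorem HasWeakDeriv.add {ℓ : ℝ} {s : ℕ} {ξ η ξ' η' : L2 ℓ} (h : HasWeakDeriv ℓ s ξ η)
    (h' : HasWeakDeriv ℓ s ξ' η') : HasWeakDeriv ℓ s (ξ + ξ') (η + η') := by
  intro φ hφ
  have key : ∀ (u v : L2 ℓ) (f : ℝ → ℂ), IsTestFunction ℓ f →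
      ∫ x in Set.Ioo 0 ℓ, conj ((u + v : L2 ℓ) x) * f x =
      (∫ x in Set.Ioo 0 ℓ, conj (u x) * f x) + ∫ x in Set.Ioo 0 ℓ, conj (v x) * f x := by
    intro u v f hf
    rw [← integral_add (integrable_mul_test u hf) (integrable_mul_test v hf)]
    refine integral_congr_ae ?_
    filter_upwards [Lp.coeFn_add u v] with x hx
    rw [hx]
    simp [add_mul]
  rw [key _ _ _ hφ, key _ _ _ (hφ.iteratedDeriv s), h φ hφ, h' φ hφ, mul_add]

theorem HasWeakDeriv.smul {ℓ : ℝ} {s : ℕ} {ξ η : L2 ℓ} (c : ℂ) (h : HasWeakDeriv ℓ s ξ η) :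
    HasWeakDeriv ℓ s (c • ξ) (c • η) := by
  intro φ hφ
  have key : ∀ (u : L2 ℓ) (f : ℝ → ℂ),
      ∫ x in Set.Ioo 0 ℓ, conj ((c • u : L2 ℓ) x) * f x =
      conj c * ∫ x in Set.Ioo 0 ℓ, conj (u x) * f x := by
    intro u f
    rw [← integral_const_mul]
    refine integral_congr_ae ?_
    filter_upwards [Lp.coeFn_smul c u] with x hx
    rw [hx]
    simp [mul_assoc]
  rw [key, key, h φ hφ]
  ring

/-- The weak derivative is unique. -/
theorem HasWeakDeriv.unique {ℓ : ℝ} {s : ℕ} {ξ η η' : L2 ℓ} (h : HasWeakDeriv ℓ s ξ η)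
    (h' : HasWeakDeriv ℓ s ξ η') : η = η' := by
  have hd : HasWeakDeriv ℓ s 0 (η + (-1 : ℂ) • η') := by
    have := h.add (h'.smul (-1))
    simpa using this
  suffices hz : η + (-1 : ℂ) • η' = 0 by
    rw [neg_one_smul, ← sub_eq_add_neg] at hz
    exact sub_eq_zero.1 hz
  set ζ := η + (-1 : ℂ) • η' with hζ
  have h1 : MemLp (fun x => conj (ζ x)) 2 (μ ℓ) := (Lp.memLp ζ).star
  have h2 : IntegrableOn (fun x => conj (ζ x)) (Set.Ioo 0 ℓ) := h1.integrable (by norm_num)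
  have h3 := isOpen_Ioo.ae_eq_zero_of_integral_contDiff_smul_eq_zero
    (μ := volume) (U := Set.Ioo 0 ℓ) h2.locallyIntegrableOn (by
      intro g hg hgc hgs
      have hsupp : Function.support (fun x => (g x : ℂ)) = Function.support g := by
        ext x; simp
      have ht : IsTestFunction ℓ (fun x => (g x : ℂ)) := by
        refine ⟨Complex.ofRealCLM.contDiff.comp hg, ?_, ?_⟩
        · unfold HasCompactSupport tsupport; rw [hsupp]; exact hgc
        · unfold tsupport; rw [hsupp]; exact hgs
      have e := hd _ ht
      have e0 := HasWeakDeriv.zero ℓ s _ ht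
      rw [← e0] at e
      have e1 : ∫ x in Set.Ioo 0 ℓ, conj ((0 : L2 ℓ) x) * (g x : ℂ) = 0 := by
        rw [integral_congr_ae (g := fun _ => (0 : ℂ))]
        · simp
        · filter_upwards [Lp.coeFn_zero ℂ 2 (μ ℓ)] with x hx
          rw [hx]
          simp
      rw [e1] at e
      rw [← e, ← setIntegral_eq_integral_of_forall_compl_eq_zero (s := Set.Ioo 0 ℓ)]
      · refine integral_congr_ae (Eventually.of_forall fun x => ?_)
        simp [mul_comm]
      · intro x hx
        have : g x = 0 := by
          by_contra hne
          exact hx (hgs (subset_tsupport _ hne))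
        simp [this])
  rw [Lp.eq_zero_iff_ae_eq_zero]
  refine (ae_restrict_iff' measurableSet_Ioo).2 ?_
  filter_upwards [h3] with x hx hxm
  simpa using hx hxm

theorem iteratedDeriv_iterate_add (s t : ℕ) (φ : ℝ → ℂ) :
    iteratedDeriv (s + t) φ = iteratedDeriv s (iteratedDeriv t φ) := by
  simp only [iteratedDeriv_eq_iterate, Function.iterate_add_apply]

theorem HasWeakDeriv.trans {ℓ : ℝ} {s t : ℕ} {ξ η ζ : L2 ℓ} (h : HasWeakDeriv ℓ s ξ η)
    (h' : HasWeakDeriv ℓ t η ζ) : HasWeakDeriv ℓ (s + t) ξ ζ := by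
  intro φ hφ
  rw [h' φ hφ, h _ (hφ.iteratedDeriv t), ← iteratedDeriv_iterate_add, pow_add, ← mul_assoc,
    mul_comm ((-1 : ℂ) ^ t)]

theorem HasWeakDeriv.cancel {ℓ : ℝ} {s t : ℕ} {ξ η ζ : L2 ℓ} (h : HasWeakDeriv ℓ s ξ η)
    (h' : HasWeakDeriv ℓ (s + t) ξ ζ) : HasWeakDeriv ℓ t η ζ := by
  intro φ hφ
  rw [h' φ hφ, h _ (hφ.iteratedDeriv t), ← iteratedDeriv_iterate_add, pow_add, ← mul_assoc,
    mul_comm ((-1 : ℂ) ^ t)]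

theorem HasWeakDeriv.self {ℓ : ℝ} (ξ : L2 ℓ) : HasWeakDeriv ℓ 0 ξ ξ := by
  intro φ _
  simp

/-! ### Differential operators of first order -/

/-- Graph of the first order operator `δ` with the condition `ξ(0) = 0` imposed iff `p` is true and
`ξ(ℓ) = 0` imposed iff `q` is true. -/
def deltaGraph (ℓ : ℝ) (p q : Bool) : Submodule ℂ (L2 ℓ × L2 ℓ) where
  carrier := {z | HasWeakDeriv ℓ 1 z.1 z.2 ∧ (p = true → VanishesAt ℓ z.1 0) ∧
    (q = true → VanishesAt ℓ z.1 ℓ)}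
  zero_mem' := ⟨.zero ℓ 1, fun _ => .zero ℓ 0, fun _ => .zero ℓ ℓ⟩
  add_mem' h h' := ⟨h.1.add h'.1, fun e => (h.2.1 e).add (h'.2.1 e),
    fun e => (h.2.2 e).add (h'.2.2 e)⟩
  smul_mem' c _ h := ⟨h.1.smul c, fun e => (h.2.1 e).smul c, fun e => (h.2.2 e).smul c⟩

/-- The four first order operators `δ ξ = ξ'` on `{ξ ∈ W¹ | p → ξ(0) = 0, q → ξ(ℓ) = 0}`
(`true` is the index `+`, `false` the index `-`). -/
def delta (ℓ : ℝ) (p q : Bool) : L2 ℓ →ₗ.[ℂ] L2 ℓ := (deltaGraph ℓ p q).toLinearPMap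

theorem mem_graph_delta (ℓ : ℝ) (p q : Bool) (ξ η : L2 ℓ) :
    (ξ, η) ∈ (delta ℓ p q).graph ↔ HasWeakDeriv ℓ 1 ξ η ∧ (p = true → VanishesAt ℓ ξ 0) ∧
      (q = true → VanishesAt ℓ ξ ℓ) := by
  rw [delta, Submodule.toLinearPMap_graph_eq]
  · rfl
  · rintro ⟨x, y⟩ hx (h0 : x = 0)
    subst h0
    exact hx.1.unique (HasWeakDeriv.zero ℓ 1)

/-! ### Supports of the beam and the fourth order operators -/

/-- Support of one end of the beam: (a) flexible, (b) fixed, (c) free. -/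
inductive EndSupport
  | flexible
  | fixed
  | free

/-- The orders `k` of the derivatives for which `ξ^(k) = 0` is imposed at the end. -/
def EndSupport.orders : EndSupport → Finset ℕ
  | flexible => {0, 2}
  | fixed => {0, 1}
  | free => {2, 3}

/-- The support cases: any support at the left end and any at the right end, and three more. -/
inductive Support
  | ends (left right : EndSupport)
  | addI
  | addII
  | addIII

/-- The orders `k` for which the boundary condition `ξ^(k)(0) = 0` is imposed. -/
def Support.left : Support → Finset ℕ
  | ends l _ => l.orders
  | addI => {1, 3}
  | addII => {0, 2}
  | addIII => {1, 3}

/-- The orders `k` for which the boundary condition `ξ^(k)(ℓ) = 0` is imposed. -/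
def Support.right : Support → Finset ℕ
  | ends _ r => r.orders
  | addI => {1, 3}
  | addII => {1, 3}
  | addIII => {0, 2}

/-- The factor of the product operator that differentiates `ξ^(k)`. -/
def Support.factor (S : Support) (ℓ : ℝ) (k : ℕ) : L2 ℓ →ₗ.[ℂ] L2 ℓ :=
  delta ℓ (decide (k ∈ S.left)) (decide (k ∈ S.right))

/-- The product operator `Â` of fourth order: `Â ξ = ξ''''`, with the four boundary conditions. -/
def productOp (ℓ : ℝ) (S : Support) : L2 ℓ →ₗ.[ℂ] L2 ℓ :=
  opProd (S.factor ℓ 3) (opProd (S.factor ℓ 2) (opProd (S.factor ℓ 1) (S.factor ℓ 0)))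

/-- `ξ` fulfils those boundary conditions of the support that concern `ξ^(k)` with `k < m`. -/
def FulfilsBV (ℓ : ℝ) (S : Support) (m : ℕ) (ξ : L2 ℓ) : Prop :=
  ∀ k < m, (k ∈ S.left → DerivVanishesAt ℓ k ξ 0) ∧ (k ∈ S.right → DerivVanishesAt ℓ k ξ ℓ)

/-- `Â` is `ξ ↦ ξ''''` on the set of all `ξ ∈ W⁴` that fulfil all boundary conditions. -/
theorem mem_graph_productOp (ℓ : ℝ) (S : Support) (ξ η : L2 ℓ) :
    (ξ, η) ∈ (productOp ℓ S).graph ↔ ξ ∈ W ℓ 4 ∧ FulfilsBV ℓ S 4 ξ ∧ HasWeakDeriv ℓ 4 ξ η := by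
  simp only [productOp, mem_graph_opProd, Support.factor, mem_graph_delta, decide_eq_true_eq]
  constructor
  · rintro ⟨η₃, ⟨η₂, ⟨η₁, ⟨h1, a0, b0⟩, h2, a1, b1⟩, h3, a2, b2⟩, h4, a3, b3⟩
    have d2 : HasWeakDeriv ℓ 2 ξ η₂ := h1.trans h2
    have d3 : HasWeakDeriv ℓ 3 ξ η₃ := d2.trans h3
    have d4 : HasWeakDeriv ℓ 4 ξ η := d3.trans h4
    refine ⟨?_, ?_, d4⟩
    · intro s hs
      interval_cases s
      exacts [⟨_, .self ξ⟩, ⟨_, h1⟩, ⟨_, d2⟩, ⟨_, d3⟩, ⟨_, d4⟩]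
    · intro k hk
      interval_cases k
      exacts [⟨fun h => ⟨_, .self ξ, a0 h⟩, fun h => ⟨_, .self ξ, b0 h⟩⟩,
        ⟨fun h => ⟨_, h1, a1 h⟩, fun h => ⟨_, h1, b1 h⟩⟩,
        ⟨fun h => ⟨_, d2, a2 h⟩, fun h => ⟨_, d2, b2 h⟩⟩,
        ⟨fun h => ⟨_, d3, a3 h⟩, fun h => ⟨_, d3, b3 h⟩⟩]
  · rintro ⟨hW, hB, d4⟩
    obtain ⟨η₁, d1⟩ := hW 1 (by norm_num)
    obtain ⟨η₂, d2⟩ := hW 2 (by norm_num)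
    obtain ⟨η₃, d3⟩ := hW 3 (by norm_num)
    have key : ∀ {k : ℕ} {ζ : L2 ℓ} {x : ℝ}, HasWeakDeriv ℓ k ξ ζ → DerivVanishesAt ℓ k ξ x →
        VanishesAt ℓ ζ x := by
      rintro k ζ x h ⟨ζ', h', hx⟩
      rwa [h.unique h']
    have b0 := hB 0 (by norm_num)
    have b1 := hB 1 (by norm_num)
    have b2 := hB 2 (by norm_num)
    have b3 := hB 3 (by norm_num)
    exact ⟨η₃, ⟨η₂, ⟨η₁, ⟨d1, fun h => key (.self ξ) (b0.1 h), fun h => key (.self ξ) (b0.2 h)⟩,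
      d1.cancel d2, fun h => key d1 (b1.1 h), fun h => key d1 (b1.2 h)⟩,
      d2.cancel d3, fun h => key d2 (b2.1 h), fun h => key d2 (b2.2 h)⟩,
      d3.cancel d4, fun h => key d3 (b3.1 h), fun h => key d3 (b3.2 h)⟩

/-- `A` is the positive selfadjoint beam operator for the support `S`: a positive, selfadjoint
extension of `Â` whose domain consists of functions in `W²` that fulfil the boundary conditions for
`ξ` and `ξ'`. -/
structure IsBeamOperator (ℓ : ℝ) (S : Support) (A : L2 ℓ →ₗ.[ℂ] L2 ℓ) : Prop where
  selfAdjoint : IsSelfAdjoint A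
  positive : ∀ ξ : A.domain, 0 ≤ inner ℂ (ξ : L2 ℓ) (A ξ)
  extends_productOp : productOp ℓ S ≤ A
  domain_subset : (A.domain : Set (L2 ℓ)) ⊆ {ξ | ξ ∈ W ℓ 2 ∧ FulfilsBV ℓ S 2 ξ}

/-- The class in `L²((0,ℓ))` of the linear function `x ↦ a + b x`. -/
def linearFn (ℓ : ℝ) (a b : ℂ) : L2 ℓ :=
  MemLp.toLp (fun x : ℝ => a + b * x) (by
    have hc : Continuous (fun x : ℝ => a + b * x) := by fun_prop
    refine MemLp.of_bound hc.aestronglyMeasurable (‖a‖ + ‖b‖ * ℓ) ?_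
    refine (ae_restrict_iff' measurableSet_Ioo).2 (Eventually.of_forall fun x hx => ?_)
    refine (norm_add_le _ _).trans ?_
    rw [norm_mul, Complex.norm_real, Real.norm_eq_abs, abs_of_pos hx.1]
    have := hx.2.le
    gcongr)

end Beam

end

/-! Spectrum: since `A` is positive and selfadjoint, `A + 1` has a bounded inverse `R` on all of
`L²`, with range in `dom A`, hence in `W¹`. By the closed graph theorem `y ↦ (R y)'` is bounded, and
`R y` is the primitive of `(R y)'` plus a constant. The Volterra operator is compact by
Arzelà–Ascoli, so `R` is compact (`isCompactOperator_of_range_subset_W`). The spectral theorem for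
compact symmetric operators yields a basis of eigenvectors; an eigenvalue `m` of `R` corresponds to
the eigenvalue `m⁻¹ - 1` of `A`, and the Fredholm alternative leaves no other spectrum
(`exists_monotone_eigenbasis`, `spectrum_eq_pointSpectrum`).

Kernel: the domain of `A` is only known to lie in `W²` with the conditions on `ξ` and `ξ'`, so
everything else is extracted from `A ξ = 0` by duality: `ξ` is orthogonal to `f''''` for every
smooth `f` in `dom Â`. Test functions `f` show that `ξ` is a polynomial `p` of degree at most 3.
Choosing `f` with free values of `f` or `f'` at an end, Green's formula gives `p''' = 0` where `ξ`
is unconstrained and `p'' = 0` where `ξ'` is unconstrained (`IsBeamOperator.natural_conditions`).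
These kill every boundary term in `∫ |p''|²`, so `p` is linear, and a finite check on its two
coefficients remains (`IsBeamOperator.mem_ker_iff`). -/

noncomputable section

namespace Beam

/-! ### The bounded inverse of `A + 1` for a positive selfadjoint operator. -/

section SelfAdjoint

variable {H : Type*} [NormedAddCommGroup H] [InnerProductSpace ℂ H]
variable {A : H →ₗ.[ℂ] H}

theorem inner_apply_left_of_isSelfAdjoint [CompleteSpace H] (hA : IsSelfAdjoint A) (x y : A.domain) :
    inner ℂ (A x) (y : H) = inner ℂ (x : H) (A y) := by
  have h := LinearPMap.adjoint_isFormalAdjoint hA.dense_domain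
  rw [LinearPMap.isSelfAdjoint_def.1 hA] at h
  exact h x y

/-- This is the half of selfadjointness that goes beyond symmetry: the hypothesis places the pair in
the graph of the adjoint, which is `A` itself. -/
theorem mem_graph_of_isSelfAdjoint [CompleteSpace H] (hA : IsSelfAdjoint A) {v w : H}
    (h : ∀ x : A.domain, inner ℂ (A x) v = inner ℂ (x : H) w) : (v, w) ∈ A.graph := by
  have e := LinearPMap.adjoint_graph_eq_graph_adjoint hA.dense_domain
  rw [LinearPMap.isSelfAdjoint_def.1 hA] at e
  rw [e, Submodule.mem_adjoint_iff]
  intro a b hab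
  obtain ⟨x, rfl, rfl⟩ := (LinearPMap.mem_graph_iff _).1 hab
  rw [h x, sub_self]

/-- Positivity gives `‖x‖² ≤ re ⟪x, A x + x⟫`, and Cauchy–Schwarz does the rest. The bound serves
for injectivity, closed range and continuity of the inverse. -/
theorem norm_le_norm_apply_add_self (hpos : ∀ x : A.domain, 0 ≤ inner ℂ (x : H) (A x))
    (x : A.domain) : ‖(x : H)‖ ≤ ‖A x + (x : H)‖ := by
  have h1 : 0 ≤ RCLike.re (inner ℂ (x : H) (A x)) := (RCLike.le_iff_re_im.1 (hpos x)).1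
  have h2 : RCLike.re (inner ℂ (x : H) (A x + (x : H))) =
      RCLike.re (inner ℂ (x : H) (A x)) + ‖(x : H)‖ ^ 2 := by
    rw [inner_add_right, map_add, inner_self_eq_norm_sq]
  have h3 : RCLike.re (inner ℂ (x : H) (A x + (x : H))) ≤ ‖(x : H)‖ * ‖A x + (x : H)‖ :=
    (RCLike.re_le_norm _).trans (norm_inner_le_norm _ _)
  rcases (norm_nonneg (x : H)).eq_or_lt with h0 | h0
  · rw [← h0]; positivity
  · exact le_of_mul_le_mul_left (by nlinarith) h0

/-- The range of `A + 1` is closed, being the image of the complete graph under an antilipschitz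
map. A vector `v` orthogonal to it satisfies `A v = -v`, which the lower bound allows only for `v =
0`. -/
theorem surjective_apply_add_self [CompleteSpace H] (hA : IsSelfAdjoint A)
    (hpos : ∀ x : A.domain, 0 ≤ inner ℂ (x : H) (A x)) (y : H) :
    ∃ x : A.domain, A x + (x : H) = y := by
  have hcl : IsClosed (A.graph : Set (H × H)) := hA.isClosed
  have : CompleteSpace A.graph := hcl.completeSpace_coe
  let G : A.graph →L[ℂ] H :=
    (ContinuousLinearMap.snd ℂ H H + ContinuousLinearMap.fst ℂ H H).comp A.graph.subtypeL
  -- The graph carries the maximum norm, and `‖A x‖ ≤ ‖A x + x‖ + ‖x‖ ≤ 2 ‖A x + x‖`.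
  have hG : ∀ z : A.graph, ‖z‖ ≤ (2 : NNReal) * ‖G z‖ := by
    rintro ⟨⟨a, b⟩, hz⟩
    obtain ⟨x, rfl, rfl⟩ := (LinearPMap.mem_graph_iff _).1 hz
    have h1 := norm_le_norm_apply_add_self hpos x
    have h2 : ‖A x‖ ≤ ‖A x + (x : H)‖ + ‖(x : H)‖ := by
      simpa using norm_sub_le (A x + (x : H)) x
    change max ‖(x : H)‖ ‖A x‖ ≤ 2 * ‖A x + (x : H)‖
    have := norm_nonneg (A x + (x : H))
    refine max_le ?_ ?_ <;> linarith
  have hr : IsClosed (LinearMap.range G.toLinearMap : Set H) := by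
    rw [LinearMap.coe_range]
    exact (AddMonoidHomClass.antilipschitz_of_bound G hG).isClosed_range G.uniformContinuous
  have : CompleteSpace (LinearMap.range G.toLinearMap) := hr.completeSpace_coe
  have htop : LinearMap.range G.toLinearMap = ⊤ := by
    rw [← Submodule.orthogonal_eq_bot_iff, Submodule.eq_bot_iff]
    intro v hv
    rw [Submodule.mem_orthogonal] at hv
    have hv' : ∀ x : A.domain, inner ℂ (A x) v = inner ℂ (x : H) (-v) := by
      intro x
      have := hv (A x + x) ⟨⟨(x, A x), A.mem_graph x⟩, rfl⟩
      rw [inner_add_left] at this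
      rw [inner_neg_right]
      exact eq_neg_of_add_eq_zero_left this
    obtain ⟨x, hx1, hx2⟩ := (LinearPMap.mem_graph_iff _).1 (mem_graph_of_isSelfAdjoint hA hv')
    simp only at hx1 hx2
    have h1 := norm_le_norm_apply_add_self hpos x
    rw [hx2, hx1] at h1
    simpa using h1
  obtain ⟨⟨⟨a, b⟩, hz⟩, hy⟩ := (LinearMap.range_eq_top.1 htop) y
  obtain ⟨x, rfl, rfl⟩ := (LinearPMap.mem_graph_iff _).1 hz
  exact ⟨x, hy⟩

theorem neg_one_mem_resolventSet [CompleteSpace H] (hA : IsSelfAdjoint A)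
    (hpos : ∀ x : A.domain, 0 ≤ inner ℂ (x : H) (A x)) : (-1 : ℂ) ∈ resolventSet A := by
  choose f hf using surjective_apply_add_self hA hpos
  have hinj : ∀ x y : A.domain, A x + (x : H) = A y + (y : H) → x = y := by
    intro x y h
    have := norm_le_norm_apply_add_self hpos (x - y)
    rw [LinearPMap.map_sub] at this
    have h0 : A x - A y + ((x - y : A.domain) : H) = 0 := by
      rw [Submodule.coe_sub, sub_add_sub_comm, h, sub_self]
    rw [h0, norm_zero] at this
    have := norm_le_zero_iff.1 this
    exact sub_eq_zero.1 (Subtype.ext this)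
  let R : H →ₗ[ℂ] H :=
    { toFun := fun y => f y
      map_add' := fun y z => by
        rw [← Submodule.coe_add]
        congr 1
        apply hinj
        rw [hf, LinearPMap.map_add, Submodule.coe_add, add_add_add_comm, hf, hf]
      map_smul' := fun c y => by
        rw [RingHom.id_apply, ← Submodule.coe_smul]
        congr 1
        apply hinj
        rw [hf, LinearPMap.map_smul, Submodule.coe_smul, ← smul_add, hf] }
  refine ⟨R.mkContinuous 1 fun y => ?_, fun y => ⟨(f y).2, ?_⟩, fun x => ?_⟩
  · have := norm_le_norm_apply_add_self hpos (f y)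
    rw [hf] at this
    simpa [R] using this
  · rw [neg_one_smul, sub_neg_eq_add]
    exact hf y
  · rw [neg_one_smul, sub_neg_eq_add]
    change (f (A x + x) : H) = x
    rw [hinj _ _ (hf _)]

/-- `R` is the everywhere defined bounded inverse of `A + 1`. -/
structure IsInverseAddOne (A : H →ₗ.[ℂ] H) (R : H →L[ℂ] H) : Prop where
  mem_domain : ∀ y, R y ∈ A.domain
  apply_add : ∀ y, A ⟨R y, mem_domain y⟩ + R y = y
  apply_left : ∀ x : A.domain, R (A x + x) = x

theorem exists_isInverseAddOne [CompleteSpace H] (hA : IsSelfAdjoint A)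
    (hpos : ∀ x : A.domain, 0 ≤ inner ℂ (x : H) (A x)) : ∃ R, IsInverseAddOne A R := by
  obtain ⟨R, h1, h2⟩ := neg_one_mem_resolventSet hA hpos
  refine ⟨R, fun y => (h1 y).1, fun y => ?_, fun x => ?_⟩
  · simpa using (h1 y).2
  · simpa using h2 x

variable {R : H →L[ℂ] H}

theorem IsInverseAddOne.injective (hR : IsInverseAddOne A R) : Function.Injective R := by
  rw [injective_iff_map_eq_zero]
  intro y hy
  have h := hR.apply_add y
  have h0 : (⟨R y, hR.mem_domain y⟩ : A.domain) = 0 := Subtype.ext hy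
  rw [h0, LinearPMap.map_zero, hy, add_zero] at h
  exact h.symm

theorem IsInverseAddOne.isSymmetric [CompleteSpace H] (hR : IsInverseAddOne A R)
    (hA : IsSelfAdjoint A) :
    (R : H →ₗ[ℂ] H).IsSymmetric := by
  intro x y
  have h := inner_apply_left_of_isSelfAdjoint hA ⟨R x, hR.mem_domain x⟩ ⟨R y, hR.mem_domain y⟩
  have hx := hR.apply_add x
  have hy := hR.apply_add y
  change inner ℂ (R x) y = inner ℂ x (R y)
  conv_lhs => rw [← hy]
  conv_rhs => rw [← hx]
  rw [inner_add_right, inner_add_left, h]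

theorem IsInverseAddOne.apply_of_eq_smul (hR : IsInverseAddOne A R) {μ : ℂ} {x : H} (hμ : μ ≠ 0)
    (h : R x = μ • x) : ∃ hx : x ∈ A.domain, A ⟨x, hx⟩ = (μ⁻¹ - 1) • x := by
  have e : x = μ⁻¹ • R x := by rw [h, inv_smul_smul₀ hμ]
  have hx : x ∈ A.domain := by
    rw [e]; exact A.domain.smul_mem _ (hR.mem_domain x)
  refine ⟨hx, ?_⟩
  have e' : (⟨x, hx⟩ : A.domain) = μ⁻¹ • ⟨R x, hR.mem_domain x⟩ := Subtype.ext e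
  rw [e', LinearPMap.map_smul, eq_sub_of_add_eq (hR.apply_add x), smul_sub, ← e, sub_smul, one_smul]

end SelfAdjoint

/-- A function on an infinite type with finite sublevel sets can be arranged in increasing order. -/
theorem exists_equiv_nat_monotone {ι : Type*} [Infinite ι] (b : ι → ℝ)
    (hb : ∀ c, {i | b i ≤ c}.Finite) : ∃ e : ℕ ≃ ι, Monotone (b ∘ e) := by
  have : Countable ι := by
    have : (⋃ n : ℕ, {i | b i ≤ n}).Countable :=
      Set.countable_iUnion fun n => (hb n).countable
    have hu : (⋃ n : ℕ, {i | b i ≤ n}) = Set.univ := by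
      ext i
      simpa using exists_nat_ge (b i)
    rw [hu] at this
    exact Set.countable_univ_iff.1 this
  obtain ⟨f, hf⟩ := exists_injective_nat ι
  -- An arbitrary injection into `ℕ` breaks ties between equal values of `b`.
  let key : ι → ℝ ×ₗ ℕ := fun i => toLex (b i, f i)
  have hkey : Function.Injective key := fun i j h => hf (by
    have := congrArg (fun p => (ofLex p).2) h
    simpa [key] using this)
  have hle : ∀ {i j}, key i ≤ key j → b i ≤ b j := by
    intro i j h
    rcases Prod.Lex.toLex_le_toLex.1 h with h | h
    · exact h.le
    · exact h.1.le
  have hfin : ∀ i, {j | key j < key i}.Finite := fun i =>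
    (hb (b i)).subset fun j hj => hle (le_of_lt hj)
  -- The rank of `i`: finite because all smaller keys lie in one sublevel set. Enumerating the range
  -- of `r` avoids having to show that every rank occurs.
  let r : ι → ℕ := fun i => {j | key j < key i}.ncard
  have hr : ∀ {i j}, key i < key j → r i < r j := by
    intro i j h
    refine Set.ncard_lt_ncard ⟨fun k hk => lt_trans hk h, fun hs => ?_⟩ (hfin j)
    exact lt_irrefl (key i) (hs (show i ∈ {k | key k < key j} from h))
  have hrinj : Function.Injective r := by
    intro i j h
    rcases lt_trichotomy (key i) (key j) with h' | h' | h'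
    · exact absurd h (hr h').ne
    · exact hkey h'
    · exact absurd h (hr h').ne'
  have : Infinite (Set.range r) := Set.infinite_coe_iff.2 (Set.infinite_range_of_injective hrinj)
  classical
  let o := Nat.Subtype.orderIsoOfNat (Set.range r)
  let e : ℕ ≃ ι := o.toEquiv.trans (Equiv.ofInjective r hrinj).symm
  refine ⟨e, fun m n hmn => ?_⟩
  have hre : ∀ n, r (e n) = o n := fun n =>
    congrArg Subtype.val ((Equiv.ofInjective r hrinj).apply_symm_apply (o n))
  have h1 : r (e m) ≤ r (e n) := by
    rw [hre, hre]; exact o.monotone hmn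
  exact hle (not_lt.1 fun h => h1.not_gt (hr h))

/-! ### Compact symmetric operators. -/

section CompactResolvent

universe u

variable {H : Type u} [NormedAddCommGroup H] [InnerProductSpace ℂ H]

theorem mem_orthogonal_of_inner_hilbertBasis_eq_zero {K : Submodule ℂ H} {ι : Type*}
    (b : HilbertBasis ι ℂ K) {x : H} (hx : ∀ i, inner ℂ (b i : H) x = 0) : x ∈ Kᗮ := by
  rw [Submodule.mem_orthogonal]
  intro u hu
  have hmem : (⟨u, hu⟩ : K) ∈ (Submodule.span ℂ (Set.range b)).topologicalClosure := by
    rw [b.dense_span]; trivial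
  have hclosed : IsClosed {v : K | inner ℂ (v : H) x = 0} :=
    isClosed_eq (by fun_prop) continuous_const
  refine closure_minimal (fun v hv => ?_) hclosed hmem
  change inner ℂ (v : H) x = 0
  induction hv using Submodule.span_induction with
  | mem v hv => obtain ⟨i, rfl⟩ := hv; exact hx i
  | zero => simp
  | add v v' _ _ h h' => rw [Submodule.coe_add, inner_add_left, h, h', add_zero]
  | smul c v _ h => rw [Submodule.coe_smul, inner_smul_left, h, mul_zero]

/-- Hilbert bases of the eigenspaces are glued over all `z : ℂ`; the zero eigenspaces contribute
nothing. Symmetry makes distinct eigenspaces orthogonal, and compactness makes their sum dense. -/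
theorem exists_hilbertBasis_of_isCompactOperator [CompleteSpace H] {R : H →L[ℂ] H}
    (hR : IsCompactOperator R)
    (hs : (R : H →ₗ[ℂ] H).IsSymmetric) :
    ∃ (ι : Type u) (b : HilbertBasis ι ℂ H) (m : ι → ℂ), ∀ i, R (b i) = m i • b i := by
  let E : ℂ → Submodule ℂ H := fun z => Module.End.eigenspace (R : H →ₗ[ℂ] H) z
  have hcl : ∀ z, IsClosed (E z : Set H) := by
    intro z
    have : (E z : Set H) = {x | R x = z • x} := by
      ext x; exact Module.End.mem_eigenspace_iff
    rw [this]
    exact isClosed_eq R.continuous (continuous_const_smul z)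
  have : ∀ z, CompleteSpace (E z) := fun z => (hcl z).completeSpace_coe
  choose w b _ using fun z => exists_hilbertBasis ℂ (E z)
  have hO : OrthogonalFamily ℂ (fun z => E z) fun z => (E z).subtypeₗᵢ :=
    hs.orthogonalFamily_eigenspaces
  have hon := hO.orthonormal_sigma_orthonormal (fun z => (b z).orthonormal)
  have hsp : (Submodule.span ℂ (Set.range
      fun a : Σ z, w z => (E a.1).subtypeₗᵢ (b a.1 a.2)))ᗮ = ⊥ := by
    rw [Submodule.eq_bot_iff]
    intro x hx
    have h2 := ContinuousLinearMap.orthogonalComplement_iSup_eigenspaces_eq_bot hR hs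
    rw [Submodule.eq_bot_iff] at h2
    apply h2
    rw [← Submodule.iInf_orthogonal, Submodule.mem_iInf]
    intro z
    refine mem_orthogonal_of_inner_hilbertBasis_eq_zero (b z) fun i => ?_
    exact (Submodule.mem_orthogonal _ _).1 hx _ (Submodule.subset_span ⟨⟨z, i⟩, rfl⟩)
  refine ⟨_, HilbertBasis.mkOfOrthogonalEqBot hon hsp, fun a => a.1, fun a => ?_⟩
  rw [HilbertBasis.coe_mkOfOrthogonalEqBot]
  exact Module.End.mem_eigenspace_iff.1 (b a.1 a.2).2

/-- Orthonormality gives `‖R (b i) - R (b j)‖ ≥ ‖m i‖ ≥ ε` for distinct such indices, so infinitely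
many of them would yield a sequence in a compact set without a Cauchy subsequence. -/
theorem finite_norm_ge_of_isCompactOperator {R : H →L[ℂ] H} (hR : IsCompactOperator R)
    {ι : Type*} {b : ι → H} (hb : Orthonormal ℂ b) {m : ι → ℂ} (h : ∀ i, R (b i) = m i • b i)
    {ε : ℝ} (hε : 0 < ε) : {i | ε ≤ ‖m i‖}.Finite := by
  by_contra hinf
  have hinf : {i | ε ≤ ‖m i‖}.Infinite := hinf
  let f := hinf.natEmbedding
  obtain ⟨K, hK, hK'⟩ := hR.image_closedBall_subset_compact 1
  obtain ⟨y, -, φ, hφ, hy⟩ := hK.tendsto_subseq (x := fun n => R (b (f n)))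
    (fun n => hK' ⟨b (f n), by simp [hb.1], rfl⟩)
  obtain ⟨N, hN⟩ := Metric.cauchySeq_iff'.1 hy.cauchySeq ε hε
  have h1 := hN (N + 1) (Nat.le_succ N)
  have hne : (f (φ (N + 1)) : ι) ≠ f (φ N) := fun e => by
    have := hφ.injective (f.injective (Subtype.ext e))
    omega
  set i := (f (φ (N + 1)) : ι)
  set j := (f (φ N) : ι)
  have h2 : ε ≤ ‖m i‖ := (f (φ (N + 1))).2
  have h3 : inner ℂ (b i) (R (b i) - R (b j)) = m i := by
    rw [h, h, inner_sub_right, inner_smul_right, inner_smul_right, hb.2 hne,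
      inner_self_eq_norm_sq_to_K, hb.1]
    simp
  have h4 : ‖m i‖ ≤ ‖R (b i) - R (b j)‖ := by
    rw [← h3]
    have := norm_inner_le_norm (𝕜 := ℂ) (b i) (R (b i) - R (b j))
    rwa [hb.1, one_mul] at this
  rw [dist_eq_norm] at h1
  exact (h2.trans h4).not_gt h1

end CompactResolvent

/-! ### Eigenvalues, multiplicities and spectrum of an operator with compact resolvent. -/

section Eigenbasis

universe u

variable {H : Type u} [NormedAddCommGroup H] [InnerProductSpace ℂ H]
variable {A : H →ₗ.[ℂ] H} {R : H →L[ℂ] H}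

theorem exists_monotone_eigenbasis [CompleteSpace H] (hA : IsSelfAdjoint A)
    (hpos : ∀ x : A.domain, 0 ≤ inner ℂ (x : H) (A x)) (hR : IsInverseAddOne A R)
    (hc : IsCompactOperator R) (hH : ¬ FiniteDimensional ℂ H) :
    ∃ (ψ : HilbertBasis ℕ ℂ H) (a : ℕ → ℝ),
      (∀ n, ∃ h : ψ n ∈ A.domain, A ⟨ψ n, h⟩ = (a n : ℂ) • ψ n) ∧
      (∀ n, 0 ≤ a n) ∧ Monotone a ∧ Tendsto a atTop atTop := by
  obtain ⟨ι, b, m, hb⟩ := exists_hilbertBasis_of_isCompactOperator hc (hR.isSymmetric hA)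
  have hb0 : ∀ i, b i ≠ 0 := fun i => b.orthonormal.ne_zero i
  have hm : ∀ i, m i ≠ 0 := fun i h0 => hb0 i <| hR.injective <| by
    rw [hb, h0, zero_smul, map_zero]
  have hι : Infinite ι := by
    by_contra hfin
    rw [not_infinite_iff_finite] at hfin
    have := Fintype.ofFinite ι
    exact hH b.toOrthonormalBasis.toBasis.finiteDimensional_of_finite
  have hAb := fun i => hR.apply_of_eq_smul (hm i) (hb i)
  have hp : ∀ i, 0 ≤ (m i)⁻¹ - 1 := by
    intro i
    obtain ⟨h1, h2⟩ := hAb i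
    have := hpos ⟨b i, h1⟩
    rw [h2, inner_smul_right, inner_self_eq_norm_sq_to_K, b.orthonormal.1] at this
    simpa using this
  let c : ι → ℝ := fun i => ((m i)⁻¹ - 1).re
  have hc0 : ∀ i, 0 ≤ c i := fun i => (Complex.le_def.1 (hp i)).1
  have hcm : ∀ i, (c i : ℂ) = (m i)⁻¹ - 1 := fun i =>
    Complex.ext (by simp [c]) (by simpa using (Complex.le_def.1 (hp i)).2)
  have hfin : ∀ C, {i | c i ≤ C}.Finite := by
    intro C
    -- With `m i = (c i + 1)⁻¹`, a bound `c i ≤ C` forces `‖m i‖ ≥ (|C| + 1)⁻¹`; the absolute value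
    -- keeps this threshold positive for every `C`.
    refine (finite_norm_ge_of_isCompactOperator hc b.orthonormal hb
      (ε := (|C| + 1)⁻¹) (by positivity)).subset fun i hi => ?_
    have h1 : m i = ((c i + 1 : ℝ) : ℂ)⁻¹ := by
      push_cast
      rw [hcm, sub_add_cancel, inv_inv]
    have h2 : 0 < c i + 1 := by linarith [hc0 i]
    have h3 : c i ≤ |C| := le_trans hi (le_abs_self C)
    change (|C| + 1)⁻¹ ≤ ‖m i‖
    rw [h1, norm_inv, Complex.norm_real, Real.norm_of_nonneg h2.le]
    gcongr
  obtain ⟨e, he⟩ := exists_equiv_nat_monotone c hfin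
  have hon : Orthonormal ℂ (b ∘ e) := b.orthonormal.comp e e.injective
  have hsp : (Submodule.span ℂ (Set.range (b ∘ e)))ᗮ = ⊥ := by
    rw [e.surjective.range_comp, ← Submodule.topologicalClosure_eq_top_iff]
    exact b.dense_span
  refine ⟨HilbertBasis.mkOfOrthogonalEqBot hon hsp, c ∘ e, fun n => ?_, fun n => hc0 _, he, ?_⟩
  · rw [HilbertBasis.coe_mkOfOrthogonalEqBot]
    simp only [Function.comp_apply, hcm]
    exact hAb (e n)
  · refine tendsto_atTop_atTop_of_monotone he fun C => ?_
    -- If `c` stayed below `C`, one finite sublevel set would be all of the infinite index type.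
    by_contra! hC
    refine Set.infinite_univ (α := ι) ((hfin C).subset fun i _ => ?_)
    have := hC (e.symm i)
    simp only [Function.comp_apply, Equiv.apply_symm_apply] at this
    exact this.le

variable {ψ : HilbertBasis ℕ ℂ H} {a : ℕ → ℝ}

theorem inner_eigenvector_eq_zero [CompleteSpace H] (hA : IsSelfAdjoint A)
    (hψ : ∀ n, ∃ h : ψ n ∈ A.domain, A ⟨ψ n, h⟩ = (a n : ℂ) • ψ n) {z : ℂ} {x : H}
    (hx : x ∈ eigenspace A z) {n : ℕ} (hn : (a n : ℂ) ≠ z) : inner ℂ (ψ n) x = 0 := by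
  obtain ⟨h1, h2⟩ := (mem_eigenspace _ _ _).1 hx
  obtain ⟨h3, h4⟩ := hψ n
  have h := inner_apply_left_of_isSelfAdjoint hA ⟨ψ n, h3⟩ ⟨x, h1⟩
  rw [h2, h4, inner_smul_left, inner_smul_right, Complex.conj_ofReal] at h
  have h' : ((a n : ℂ) - z) * inner ℂ (ψ n) x = 0 := by rw [sub_mul, h, sub_self]
  exact (mul_eq_zero.1 h').resolve_left (sub_ne_zero.2 hn)

theorem finite_setOf_eigenvalue_eq (ha : Tendsto a atTop atTop) (z : ℂ) :
    {n | (a n : ℂ) = z}.Finite := by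
  obtain ⟨N, hN⟩ := (ha.eventually_gt_atTop z.re).exists_forall_of_atTop
  refine (Set.finite_lt_nat N).subset fun n hn => ?_
  by_contra h
  have h1 := hN n (not_lt.1 h)
  rw [← (show (a n : ℂ) = z from hn), Complex.ofReal_re] at h1
  exact lt_irrefl _ h1

/-- By symmetry, an eigenvector is orthogonal to every basis vector with another eigenvalue, so its
expansion is a finite sum over the matching ones. -/
theorem eigenspace_eq_span [CompleteSpace H] (hA : IsSelfAdjoint A)
    (hψ : ∀ n, ∃ h : ψ n ∈ A.domain, A ⟨ψ n, h⟩ = (a n : ℂ) • ψ n)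
    (ha : Tendsto a atTop atTop) (z : ℂ) :
    eigenspace A z = Submodule.span ℂ (ψ '' {n | (a n : ℂ) = z}) := by
  refine le_antisymm (fun x hx => ?_) (Submodule.span_le.2 ?_)
  · rw [← (ψ.hasSum_repr x).tsum_eq, tsum_eq_sum (s := (finite_setOf_eigenvalue_eq ha z).toFinset)]
    · refine Submodule.sum_mem _ fun n hn => Submodule.smul_mem _ _ (Submodule.subset_span ?_)
      exact ⟨n, by simpa using hn, rfl⟩
    · intro n hn
      rw [ψ.repr_apply_apply, inner_eigenvector_eq_zero hA hψ hx (by simpa using hn), zero_smul]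
  · rintro _ ⟨n, hn, rfl⟩
    refine (mem_eigenspace _ _ _).2 ?_
    rw [← (show (a n : ℂ) = z from hn)]
    exact hψ n

theorem finrank_eigenspace [CompleteSpace H] (hA : IsSelfAdjoint A)
    (hψ : ∀ n, ∃ h : ψ n ∈ A.domain, A ⟨ψ n, h⟩ = (a n : ℂ) • ψ n)
    (ha : Tendsto a atTop atTop) (z : ℂ) :
    FiniteDimensional ℂ (eigenspace A z) ∧
      {n | (a n : ℂ) = z}.ncard = Module.finrank ℂ (eigenspace A z) := by
  have hfin := finite_setOf_eigenvalue_eq ha z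
  rw [eigenspace_eq_span hA hψ ha]
  refine ⟨FiniteDimensional.span_of_finite ℂ (hfin.image _), ?_⟩
  have := hfin.fintype
  have hli : LinearIndependent ℂ (fun n : {n | (a n : ℂ) = z} => ψ n) :=
    ψ.orthonormal.linearIndependent.comp _ Subtype.val_injective
  have h := finrank_span_eq_card hli
  rw [← Set.image_eq_range] at h
  rw [h, Set.ncard_eq_toFinset_card', Set.toFinset_card]

theorem pointSpectrum_eq_range [CompleteSpace H] (hA : IsSelfAdjoint A)
    (hψ : ∀ n, ∃ h : ψ n ∈ A.domain, A ⟨ψ n, h⟩ = (a n : ℂ) • ψ n)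
    (ha : Tendsto a atTop atTop) : pointSpectrum A = Set.range (fun n => (a n : ℂ)) := by
  ext z
  constructor
  · intro hz
    by_contra h
    refine hz ?_
    rw [eigenspace_eq_span hA hψ ha]
    have : {n | (a n : ℂ) = z} = ∅ := Set.eq_empty_of_forall_notMem fun n hn => h ⟨n, hn⟩
    rw [this, Set.image_empty, Submodule.span_empty]
  · rintro ⟨n, rfl⟩ h
    have h1 : ψ n ∈ eigenspace A (a n) := (mem_eigenspace _ _ _).2 (hψ n)
    rw [h, Submodule.mem_bot] at h1
    exact ψ.orthonormal.ne_zero n h1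

theorem pointSpectrum_subset_spectrum : pointSpectrum A ⊆ spectrum A := by
  rintro z hz ⟨Q, -, hQ⟩
  refine hz ((Submodule.eq_bot_iff _).2 fun x hx => ?_)
  obtain ⟨h1, h2⟩ := (mem_eigenspace _ _ _).1 hx
  have := hQ ⟨x, h1⟩
  rw [h2, sub_self, map_zero] at this
  exact this.symm

/-- The Fredholm alternative for `R` at `(z + 1)⁻¹`: either this is an eigenvalue of `R`, which
makes `z` an eigenvalue of `A`, or `(z + 1)⁻¹ - R` is invertible. The point `z = -1` is separate,
since there `R` itself is the resolvent. -/
theorem spectrum_eq_pointSpectrum [CompleteSpace H] (hR : IsInverseAddOne A R)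
    (hc : IsCompactOperator R) : spectrum A = pointSpectrum A := by
  refine Set.Subset.antisymm (fun z hz => ?_) pointSpectrum_subset_spectrum
  by_contra hp
  refine hz ?_
  by_cases hz1 : z = -1
  · subst hz1
    exact ⟨R, fun y => ⟨hR.mem_domain y, by simpa using hR.apply_add y⟩, fun x => by
      simpa using hR.apply_left x⟩
  have hz0 : z + 1 ≠ 0 := fun h => hz1 (eq_neg_of_add_eq_zero_left h)
  rcases hc.hasEigenvalue_or_mem_resolventSet (μ := (z + 1)⁻¹) (inv_ne_zero hz0) with h | h
  · obtain ⟨v, hv⟩ := h.exists_hasEigenvector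
    obtain ⟨h1, h2⟩ := hR.apply_of_eq_smul (inv_ne_zero hz0) (hv.apply_eq_smul)
    rw [inv_inv, add_sub_cancel_right] at h2
    refine absurd (fun hbot => ?_) hp
    have h3 : v ∈ eigenspace A z := (mem_eigenspace _ _ _).2 ⟨h1, h2⟩
    rw [hbot, Submodule.mem_bot] at h3
    exact hv.2 h3
  · rw [_root_.spectrum.mem_resolventSet_iff] at h
    obtain ⟨U, hU⟩ := h
    have e1 : ∀ y, (z + 1)⁻¹ • (U⁻¹ : (H →L[ℂ] H)ˣ).1 y - R ((U⁻¹ : (H →L[ℂ] H)ˣ).1 y) = y := by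
      intro y
      have : (U.1 * (U⁻¹ : (H →L[ℂ] H)ˣ).1) y = y := by rw [Units.mul_inv]; rfl
      rw [hU] at this
      simpa [Algebra.algebraMap_eq_smul_one] using this
    have e2 : ∀ y, (U⁻¹ : (H →L[ℂ] H)ˣ).1 ((z + 1)⁻¹ • y - R y) = y := by
      intro y
      have : ((U⁻¹ : (H →L[ℂ] H)ˣ).1 * U.1) y = y := by rw [Units.inv_mul]; rfl
      rw [hU] at this
      simpa [Algebra.algebraMap_eq_smul_one] using this
    set Q := (U⁻¹ : (H →L[ℂ] H)ˣ).1
    have e3 : ∀ y, R (Q y) = Q (R y) := by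
      intro y
      have := e2 (R (Q y))
      rw [← map_smul, ← map_sub, e1] at this
      exact this.symm
    -- On `dom A`, `A - z = (z + 1) (A + 1) ((z + 1)⁻¹ - R)`; inverting this factorization gives the
    -- resolvent, as `Q` commutes with `R`.
    refine ⟨(z + 1)⁻¹ • R.comp Q, fun y => ?_, fun x => ?_⟩
    · have hd := A.domain.smul_mem (z + 1)⁻¹ (hR.mem_domain (Q y))
      refine ⟨hd, ?_⟩
      have : (⟨_, hd⟩ : A.domain) = (z + 1)⁻¹ • ⟨R (Q y), hR.mem_domain (Q y)⟩ := rfl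
      change A ⟨_, hd⟩ - z • (z + 1)⁻¹ • R (Q y) = y
      rw [this, LinearPMap.map_smul, eq_sub_of_add_eq (hR.apply_add (Q y))]
      have h2 := e1 y
      have h3 : (z + 1)⁻¹ • R (Q y) + z • (z + 1)⁻¹ • R (Q y) = R (Q y) := by
        rw [smul_smul, ← add_smul]
        have : (z + 1)⁻¹ + z * (z + 1)⁻¹ = 1 := by field_simp; ring
        rw [this, one_smul]
      rw [smul_sub, sub_sub, h3, h2]
    · change (z + 1)⁻¹ • R (Q (A x - z • (x : H))) = x
      have h1 : A x - z • (x : H) = (A x + x) - (z + 1) • (x : H) := by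
        rw [add_smul, one_smul]; abel
      rw [e3, h1, map_sub, hR.apply_left, map_smul, ← map_smul, smul_sub, smul_smul,
        inv_mul_cancel₀ hz0, one_smul, e2]

end Eigenbasis

/-! ### Classes of continuous functions -/

section ContinuousClasses

variable {ℓ : ℝ}

theorem memLp_of_continuousOn {f : ℝ → ℂ} (hf : ContinuousOn f (Set.Icc 0 ℓ)) :
    MemLp f 2 (μ ℓ) := by
  obtain ⟨C, hC⟩ := isCompact_Icc.exists_bound_of_continuousOn hf
  refine MemLp.of_bound
    ((hf.mono Set.Ioo_subset_Icc_self).aestronglyMeasurable measurableSet_Ioo) C ?_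
  exact (ae_restrict_iff' measurableSet_Ioo).2
    (Eventually.of_forall fun x hx => hC x (Set.Ioo_subset_Icc_self hx))

/-- The class in `L²((0,ℓ))` of a continuous function. -/
def contFn (ℓ : ℝ) (f : ℝ → ℂ) (hf : Continuous f) : L2 ℓ :=
  (memLp_of_continuousOn (ℓ := ℓ) hf.continuousOn).toLp f

theorem coeFn_contFn {f : ℝ → ℂ} (hf : Continuous f) : contFn ℓ f hf =ᵐ[μ ℓ] f :=
  MemLp.coeFn_toLp _

theorem linearFn_eq_contFn (a b : ℂ) :
    linearFn ℓ a b = contFn ℓ (fun x : ℝ => a + b * x) (by fun_prop) := rfl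

theorem integral_conj_mul_eq_inner (ξ : L2 ℓ) {f : ℝ → ℂ} (hf : Continuous f) :
    ∫ x in Set.Ioo 0 ℓ, conj (ξ x) * f x = inner ℂ ξ (contFn ℓ f hf) := by
  rw [L2.inner_def]
  refine integral_congr_ae ?_
  filter_upwards [coeFn_contFn (ℓ := ℓ) hf] with x hx
  rw [hx, RCLike.inner_apply, mul_comm]

theorem inner_contFn_contFn {f g : ℝ → ℂ} (hf : Continuous f) (hg : Continuous g) :
    inner ℂ (contFn ℓ f hf) (contFn ℓ g hg) = ∫ x in Set.Ioo 0 ℓ, conj (f x) * g x := by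
  rw [← integral_conj_mul_eq_inner]
  refine integral_congr_ae ?_
  filter_upwards [coeFn_contFn (ℓ := ℓ) hf] with x hx
  rw [hx]

theorem eqOn_of_contFn_eq {f g : ℝ → ℂ} {hf : Continuous f} {hg : Continuous g}
    (h : contFn ℓ f hf = contFn ℓ g hg) : Set.EqOn f g (Set.Ioo 0 ℓ) := by
  refine Measure.eqOn_open_of_ae_eq (μ := volume) ?_ isOpen_Ioo hf.continuousOn hg.continuousOn
  have h1 := coeFn_contFn (ℓ := ℓ) hf
  rw [h] at h1
  exact h1.symm.trans (coeFn_contFn hg)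

/-- Two continuous representatives agree almost everywhere, hence on the open interval, hence at its
end points by density. -/
theorem VanishesAt.apply_eq_zero (hℓ : 0 < ℓ) {f : ℝ → ℂ} {hf : Continuous f} {x : ℝ}
    (hx : x ∈ Set.Icc 0 ℓ) (h : VanishesAt ℓ (contFn ℓ f hf) x) : f x = 0 := by
  obtain ⟨g, hg, hfg, hgx⟩ := h
  have h1 : Set.EqOn f g (Set.Ioo 0 ℓ) :=
    Measure.eqOn_open_of_ae_eq (μ := volume) ((coeFn_contFn hf).symm.trans hfg) isOpen_Ioo
      hf.continuousOn (hg.mono Set.Ioo_subset_Icc_self)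
  have h2 : Set.EqOn f g (Set.Icc 0 ℓ) := by
    refine h1.of_subset_closure hf.continuousOn hg Set.Ioo_subset_Icc_self ?_
    rw [closure_Ioo hℓ.ne]
  rw [h2 hx, hgx]

theorem vanishesAt_contFn {f : ℝ → ℂ} (hf : Continuous f) {x : ℝ} (h : f x = 0) :
    VanishesAt ℓ (contFn ℓ f hf) x :=
  ⟨f, hf.continuousOn, coeFn_contFn hf, h⟩

end ContinuousClasses

/-! ### Weak derivatives -/

section WeakDerivatives

variable {ℓ : ℝ}

/-- In this form both sides are continuous in the pair `(ξ, η)`, so the relation is closed; the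
closed graph and density arguments below rest on that. -/
theorem hasWeakDeriv_iff_inner {s : ℕ} {ξ η : L2 ℓ} :
    HasWeakDeriv ℓ s ξ η ↔ ∀ (φ : ℝ → ℂ) (h : IsTestFunction ℓ φ),
      inner ℂ η (contFn ℓ φ h.1.continuous) =
        (-1) ^ s * inner ℂ ξ (contFn ℓ _ (h.iteratedDeriv s).1.continuous) := by
  refine forall₂_congr fun φ h => ?_
  rw [integral_conj_mul_eq_inner η h.1.continuous,
    integral_conj_mul_eq_inner ξ (h.iteratedDeriv s).1.continuous]

theorem isClosed_setOf_hasWeakDeriv (ℓ : ℝ) (s : ℕ) :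
    IsClosed {z : L2 ℓ × L2 ℓ | HasWeakDeriv ℓ s z.1 z.2} := by
  simp only [hasWeakDeriv_iff_inner, Set.ofPred_forall]
  exact isClosed_iInter fun φ => isClosed_iInter fun h => isClosed_eq (by fun_prop) (by fun_prop)

theorem IsTestFunction.apply_eq_zero {φ : ℝ → ℂ} (h : IsTestFunction ℓ φ) {x : ℝ}
    (hx : x ∉ Set.Ioo 0 ℓ) : φ x = 0 := by
  by_contra hne
  exact hx (h.2.2 (subset_tsupport _ hne))

theorem hasWeakDeriv_contFn (hℓ : 0 < ℓ) {f f' : ℝ → ℂ} (hd : ∀ x, HasDerivAt f (f' x) x)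
    (hf : Continuous f) (hf' : Continuous f') :
    HasWeakDeriv ℓ 1 (contFn ℓ f hf) (contFn ℓ f' hf') := by
  rw [hasWeakDeriv_iff_inner]
  intro φ h
  rw [inner_contFn_contFn, inner_contFn_contFn]
  simp only [← integral_Ioc_eq_integral_Ioo, ← intervalIntegral.integral_of_le hℓ.le]
  simp only [iteratedDeriv_one, pow_one]
  have h1 : ∀ x, HasDerivAt (fun x => conj (f x)) (conj (f' x)) x := fun x => (hd x).star
  have h2 : ∀ x, HasDerivAt φ (deriv φ x) x := fun x =>
    (h.1.differentiable (by simp)).differentiableAt.hasDerivAt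
  have hc : Continuous (deriv φ) := by
    have := (h.iteratedDeriv 1).1.continuous
    rwa [iteratedDeriv_one] at this
  have := intervalIntegral.integral_mul_deriv_eq_deriv_mul (a := 0) (b := ℓ)
    (fun x _ => h1 x) (fun x _ => h2 x)
    ((Complex.continuous_conj.comp hf').intervalIntegrable _ _) (hc.intervalIntegrable _ _)
  rw [this, h.apply_eq_zero (x := 0) (by simp), h.apply_eq_zero (x := ℓ) (by simp)]
  simp

theorem setIntegral_Ioo_eq_intervalIntegral (hℓ : 0 < ℓ) (φ : ℝ → ℂ) :
    ∫ x in Set.Ioo 0 ℓ, φ x = ∫ x in (0)..ℓ, φ x := by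
  rw [← integral_Ioc_eq_integral_Ioo, ← intervalIntegral.integral_of_le hℓ.le]

/-- The integral from `0` vanishes to the left of the support, and to its right because the total
integral is zero. -/
theorem IsTestFunction.exists_primitive (hℓ : 0 < ℓ) {φ : ℝ → ℂ} (h : IsTestFunction ℓ φ)
    (h0 : ∫ x in Set.Ioo 0 ℓ, φ x = 0) : ∃ ψ, IsTestFunction ℓ ψ ∧ deriv ψ = φ := by
  have hc := h.1.continuous
  obtain ⟨a, b, ha, hb, hab⟩ : ∃ a b, 0 < a ∧ b < ℓ ∧ tsupport φ ⊆ Set.Icc a b := by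
    rcases (tsupport φ).eq_empty_or_nonempty with he | hne
    · exact ⟨1, ℓ - 1, by simp, by simp, by simp [he]⟩
    · obtain ⟨a, ha⟩ := h.2.1.isCompact.exists_isLeast hne
      obtain ⟨b, hb⟩ := h.2.1.isCompact.exists_isGreatest hne
      exact ⟨a, b, (h.2.2 ha.1).1, (h.2.2 hb.1).2, fun x hx => ⟨ha.2 hx, hb.2 hx⟩⟩
  have hz : ∀ x, x ∉ Set.Icc a b → φ x = 0 := fun x hx => by
    by_contra hne
    exact hx (hab (subset_tsupport _ hne))
  have hd : ∀ x, HasDerivAt (fun x => ∫ t in (0)..x, φ t) (φ x) x := fun x =>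
    intervalIntegral.integral_hasDerivAt_right (hc.intervalIntegrable _ _)
      (hc.stronglyMeasurableAtFilter _ _) hc.continuousAt
  have hderiv : deriv (fun x => ∫ t in (0)..x, φ t) = φ := funext fun x => (hd x).deriv
  have hsupp : tsupport (fun x => ∫ t in (0)..x, φ t) ⊆ Set.Icc a b := by
    refine closure_minimal (fun x hx => ?_) isClosed_Icc
    by_contra hxn
    refine hx ?_
    rw [Set.mem_Icc, not_and_or, not_le, not_le] at hxn
    rcases hxn with hx | hx
    · refine intervalIntegral.integral_zero_ae (Eventually.of_forall fun t ht => hz t fun h' => ?_)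
      have := ht.2.trans_lt (max_lt ha hx)
      exact absurd h'.1 (not_le.2 this)
    · have h1 : ∫ t in x..ℓ, φ t = 0 := by
        refine intervalIntegral.integral_zero_ae (Eventually.of_forall fun t ht => hz t fun h' => ?_)
        have := (lt_min hx hb).trans ht.1
        exact absurd h'.2 (not_le.2 this)
      have h2 := intervalIntegral.integral_add_adjacent_intervals
        (hc.intervalIntegrable (μ := volume) 0 x) (hc.intervalIntegrable x ℓ)
      rw [h1, add_zero, ← setIntegral_Ioo_eq_intervalIntegral hℓ, h0] at h2
      exact h2
  refine ⟨_, ⟨?_, isCompact_Icc.of_isClosed_subset (isClosed_tsupport _) hsupp,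
    hsupp.trans fun x hx => ⟨ha.trans_le hx.1, hx.2.trans_lt hb⟩⟩, hderiv⟩
  rw [contDiff_infty_iff_deriv, hderiv]
  exact ⟨fun x => (hd x).differentiableAt, h.1⟩

theorem exists_testFunction_integral_eq_one (hℓ : 0 < ℓ) :
    ∃ φ, IsTestFunction ℓ φ ∧ ∫ x in Set.Ioo 0 ℓ, φ x = 1 := by
  let f : ContDiffBump (ℓ / 2) := ⟨ℓ / 8, ℓ / 4, by linarith, by linarith⟩
  have hs : Function.support (fun x => (f.normed volume x : ℂ)) =
      Function.support (f.normed volume) := by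
    ext x; simp
  have ht : tsupport (fun x => (f.normed volume x : ℂ)) = Metric.closedBall (ℓ / 2) (ℓ / 4) := by
    unfold tsupport
    rw [hs]
    exact f.tsupport_normed_eq
  have hsub : tsupport (fun x => (f.normed volume x : ℂ)) ⊆ Set.Ioo 0 ℓ := by
    rw [ht, Real.closedBall_eq_Icc]
    intro x hx
    exact ⟨by linarith [hx.1], by linarith [hx.2]⟩
  refine ⟨fun x => (f.normed volume x : ℂ), ⟨Complex.ofRealCLM.contDiff.comp f.contDiff_normed,
    ?_, hsub⟩, ?_⟩
  · rw [HasCompactSupport, ht]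
    exact isCompact_closedBall _ _
  · rw [setIntegral_eq_integral_of_forall_compl_eq_zero, integral_complex_ofReal, f.integral_normed,
      Complex.ofReal_one]
    intro x hx
    by_contra hne
    exact hx (hsub (subset_tsupport _ hne))

theorem iteratedDeriv_sub_const_mul {φ ψ : ℝ → ℂ} (hφ : ContDiff ℝ ∞ φ) (hψ : ContDiff ℝ ∞ ψ)
    (c : ℂ) (s : ℕ) (x : ℝ) : iteratedDeriv s (fun x => φ x - c * ψ x) x =
      iteratedDeriv s φ x - c * iteratedDeriv s ψ x := by
  have h1 : ContDiffAt ℝ s φ x := (hφ.of_le (by exact_mod_cast le_top)).contDiffAt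
  have h2 : ContDiffAt ℝ s ψ x := (hψ.of_le (by exact_mod_cast le_top)).contDiffAt
  rw [iteratedDeriv_fun_sub h1 (contDiffAt_const.mul h2), iteratedDeriv_const_mul_field]

/-- The du Bois-Reymond argument: with `c = ∫ φ` and a fixed `φ₀` of integral 1, `φ - c φ₀` is the
derivative of a test function. Hence `φ` and `c φ₀` pair equally with `v`, and the pairing depends
on `φ` only through `∫ φ`. -/
theorem HasWeakDeriv.exists_const_of_succ_zero (hℓ : 0 < ℓ) {s : ℕ} {v : L2 ℓ}
    (h : HasWeakDeriv ℓ (s + 1) v 0) :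
    ∃ c : ℂ, HasWeakDeriv ℓ s v (contFn ℓ (fun _ => c) continuous_const) := by
  obtain ⟨φ₀, h₀, hi⟩ := exists_testFunction_integral_eq_one hℓ
  set I : ℂ := (-1) ^ s * ∫ x in Set.Ioo 0 ℓ, conj (v x) * iteratedDeriv s φ₀ x
  -- The weak derivative enters the pairing conjugated, hence `conj I`.
  refine ⟨conj I, fun φ hφ => ?_⟩
  set c : ℂ := ∫ x in Set.Ioo 0 ℓ, φ x with hc
  have hint : ∀ {φ : ℝ → ℂ}, IsTestFunction ℓ φ → Integrable φ (μ ℓ) := fun h' =>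
    (h'.1.continuous.integrable_of_hasCompactSupport h'.2.1).restrict
  have hs : Function.support (fun x => φ x - c * φ₀ x) ⊆ tsupport φ ∪ tsupport φ₀ := by
    intro x hx
    by_contra hn
    rw [Set.mem_union, not_or] at hn
    exact hx (by simp [image_eq_zero_of_notMem_tsupport hn.1,
      image_eq_zero_of_notMem_tsupport hn.2])
  have hts : tsupport (fun x => φ x - c * φ₀ x) ⊆ tsupport φ ∪ tsupport φ₀ :=
    closure_minimal hs ((isClosed_tsupport _).union (isClosed_tsupport _))
  have htest : IsTestFunction ℓ (fun x => φ x - c * φ₀ x) :=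
    ⟨hφ.1.sub (contDiff_const.mul h₀.1),
      (hφ.2.1.isCompact.union h₀.2.1.isCompact).of_isClosed_subset (isClosed_tsupport _) hts,
      hts.trans (Set.union_subset hφ.2.2 h₀.2.2)⟩
  obtain ⟨ψ, hψ, hψd⟩ := htest.exists_primitive hℓ (by
    rw [integral_sub (hint hφ) ((hint h₀).const_mul c), integral_const_mul, hi, mul_one, sub_self])
  have e := h ψ hψ
  rw [integral_conj_mul_eq_inner 0 hψ.1.continuous, inner_zero_left, iteratedDeriv_succ', hψd] at e
  simp only [iteratedDeriv_sub_const_mul hφ.1 h₀.1, mul_sub] at e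
  have e1 := integrable_mul_test v (hφ.iteratedDeriv s)
  have e2 := integrable_mul_test v (h₀.iteratedDeriv s)
  rw [integral_sub e1 (by simpa only [mul_left_comm] using e2.const_mul c)] at e
  simp only [mul_left_comm _ c] at e
  rw [integral_const_mul] at e
  rw [integral_conj_mul_eq_inner _ hφ.1.continuous, inner_contFn_contFn, integral_const_mul,
    Complex.conj_conj, ← hc]
  have hne : ((-1 : ℂ) ^ (s + 1)) ≠ 0 := pow_ne_zero _ (by norm_num)
  have e3 := (mul_eq_zero.1 e.symm).resolve_left hne
  rw [sub_eq_zero] at e3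
  rw [e3]
  ring

theorem HasWeakDeriv.eq_of_zero {ξ η : L2 ℓ} (h : HasWeakDeriv ℓ 0 ξ η) : ξ = η :=
  (HasWeakDeriv.self ξ).unique h

end WeakDerivatives

/-! ### The Volterra operator -/

section Volterra

open scoped BoundedContinuousFunction

variable {ℓ : ℝ}

theorem integrable_coeFn (η : L2 ℓ) : Integrable η (μ ℓ) :=
  (Lp.memLp η).integrable (by norm_num)

/-- Cauchy–Schwarz against the indicator of the interval. This Hölder bound of exponent 1/2 yields
both boundedness and equicontinuity of primitives. -/
theorem norm_setIntegral_le (η : L2 ℓ) {x y : ℝ} (hxy : x ≤ y) :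
    ‖∫ t in Set.Ioc x y, η t ∂μ ℓ‖ ≤ √(y - x) * ‖η‖ := by
  have hfin : μ ℓ (Set.Ioc x y) ≠ ⊤ := measure_ne_top _ _
  rw [← L2.inner_indicatorConstLp_one (𝕜 := ℂ) measurableSet_Ioc hfin η]
  refine (norm_inner_le_norm _ _).trans ?_
  gcongr
  rw [norm_indicatorConstLp (by norm_num) (by norm_num), norm_one, one_mul, Real.sqrt_eq_rpow]
  simp only [ENNReal.toReal_ofNat]
  refine Real.rpow_le_rpow measureReal_nonneg ?_ (by norm_num)
  refine ENNReal.toReal_le_of_le_ofReal (by linarith) ?_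
  rw [← Real.volume_Ioc]
  exact Measure.restrict_apply_le _ _

theorem integral_Ioc_sub (η : L2 ℓ) {x y : ℝ} (hx : 0 ≤ x) (hxy : x ≤ y) :
    (∫ t in Set.Ioc 0 y, η t ∂μ ℓ) - ∫ t in Set.Ioc 0 x, η t ∂μ ℓ =
      ∫ t in Set.Ioc x y, η t ∂μ ℓ := by
  rw [sub_eq_iff_eq_add', ← setIntegral_union (Set.Ioc_disjoint_Ioc_of_le le_rfl) measurableSet_Ioc
    (integrable_coeFn η).integrableOn (integrable_coeFn η).integrableOn,
    Set.Ioc_union_Ioc_eq_Ioc hx hxy]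

theorem norm_integral_Ioc_sub_le (η : L2 ℓ) {x y : ℝ} (hx : 0 ≤ x) (hy : 0 ≤ y) :
    ‖(∫ t in Set.Ioc 0 y, η t ∂μ ℓ) - ∫ t in Set.Ioc 0 x, η t ∂μ ℓ‖ ≤ √|y - x| * ‖η‖ := by
  rcases le_total x y with h | h
  · rw [integral_Ioc_sub η hx h, abs_of_nonneg (sub_nonneg.2 h)]
    exact norm_setIntegral_le η h
  · rw [norm_sub_rev, integral_Ioc_sub η hy h, abs_sub_comm, abs_of_nonneg (sub_nonneg.2 h)]
    exact norm_setIntegral_le η h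

theorem continuous_primitive (η : L2 ℓ) :
    Continuous fun x : Set.Icc 0 ℓ => ∫ t in Set.Ioc 0 (x : ℝ), η t ∂μ ℓ := by
  rw [continuous_iff_continuousAt]
  intro x
  rw [ContinuousAt, tendsto_iff_norm_sub_tendsto_zero]
  refine squeeze_zero (fun _ => norm_nonneg _)
    (fun y => norm_integral_Ioc_sub_le η x.2.1 y.2.1) ?_
  have : Continuous fun y : Set.Icc 0 ℓ => √|(y : ℝ) - x| * ‖η‖ := by fun_prop
  simpa using this.tendsto x

/-- The primitive that vanishes at `0`, as a continuous function on `[0,ℓ]`. -/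
def primitive (ℓ : ℝ) : L2 ℓ →L[ℂ] (Set.Icc 0 ℓ →ᵇ ℂ) :=
  LinearMap.mkContinuous
    { toFun := fun η => BoundedContinuousFunction.mkOfCompact ⟨_, continuous_primitive η⟩
      map_add' := fun η η' => by
        ext x
        change ∫ t in Set.Ioc 0 (x : ℝ), (η + η' : L2 ℓ) t ∂μ ℓ =
          (∫ t in Set.Ioc 0 (x : ℝ), η t ∂μ ℓ) + ∫ t in Set.Ioc 0 (x : ℝ), η' t ∂μ ℓ
        rw [← integral_add (integrable_coeFn η).integrableOn (integrable_coeFn η').integrableOn]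
        exact integral_congr_ae (ae_restrict_of_ae (Lp.coeFn_add η η'))
      map_smul' := fun c η => by
        ext x
        change ∫ t in Set.Ioc 0 (x : ℝ), (c • η : L2 ℓ) t ∂μ ℓ =
          c * ∫ t in Set.Ioc 0 (x : ℝ), η t ∂μ ℓ
        rw [← integral_const_mul]
        exact integral_congr_ae (ae_restrict_of_ae (Lp.coeFn_smul c η)) }
    √ℓ fun η => by
      refine (BoundedContinuousFunction.norm_le (by positivity)).2 fun x => ?_
      refine (norm_setIntegral_le η x.2.1).trans ?_
      gcongr
      linarith [x.2.2]

/-- Arzelà–Ascoli: primitives of the unit ball are bounded by `√ℓ` and share the modulus of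
continuity `√|d|`. -/
theorem isCompactOperator_primitive (ℓ : ℝ) : IsCompactOperator (primitive ℓ) := by
  refine (isCompactOperator_iff_isCompact_closure_image_closedBall
    (primitive ℓ).toLinearMap one_pos).2 ?_
  refine BoundedContinuousFunction.arzela_ascoli (Metric.closedBall 0 √ℓ)
    (isCompact_closedBall _ _) _ ?_ ?_
  · rintro _ x ⟨η, hη, rfl⟩
    rw [mem_closedBall_zero_iff] at hη ⊢
    refine (norm_setIntegral_le η x.2.1).trans ?_
    have h1 : √((x : ℝ) - 0) ≤ √ℓ := Real.sqrt_le_sqrt (by linarith [x.2.2])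
    calc _ ≤ √ℓ * 1 := by gcongr
      _ = √ℓ := mul_one _
  · refine Metric.equicontinuous_of_continuity_modulus (fun d => √|d|) ?_ _ ?_
    · have : Continuous fun d : ℝ => √|d| := by fun_prop
      simpa using this.tendsto 0
    · rintro x y ⟨_, ⟨η, hη, rfl⟩⟩
      rw [mem_closedBall_zero_iff] at hη
      rw [dist_eq_norm, dist_comm, Subtype.dist_eq, Real.dist_eq, abs_abs, norm_sub_rev]
      refine (norm_integral_Ioc_sub_le η x.2.1 y.2.1).trans ?_
      exact mul_le_of_le_one_right (Real.sqrt_nonneg _) hη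

theorem memLp_extend (hℓ : 0 < ℓ) (f : Set.Icc 0 ℓ →ᵇ ℂ) :
    MemLp (Set.IccExtend hℓ.le f) 2 (μ ℓ) :=
  memLp_of_continuousOn (f.continuous.Icc_extend').continuousOn

/-- The class in `L²((0,ℓ))` of a continuous function on `[0,ℓ]`. -/
def ofIcc (hℓ : 0 < ℓ) : (Set.Icc 0 ℓ →ᵇ ℂ) →L[ℂ] L2 ℓ :=
  LinearMap.mkContinuous
    { toFun := fun f => (memLp_extend hℓ f).toLp _
      map_add' := fun f g => MemLp.toLp_add (memLp_extend hℓ f) (memLp_extend hℓ g)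
      map_smul' := fun c f => MemLp.toLp_const_smul c (memLp_extend hℓ f) }
    (√ℓ) fun f => by
      have h : ∀ᵐ x ∂μ ℓ, ‖(memLp_extend hℓ f).toLp _ x‖ ≤ ‖f‖ := by
        filter_upwards [(memLp_extend hℓ f).coeFn_toLp] with x hx
        rw [hx]
        exact f.norm_coe_le_norm _
      refine (Lp.norm_le_of_ae_bound (norm_nonneg _) h).trans (le_of_eq ?_)
      have hm : ((measureUnivNNReal (μ ℓ) : NNReal) : ℝ) = ℓ := by
        rw [measureUnivNNReal, Measure.restrict_apply_univ, Real.volume_Ioo, sub_zero]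
        exact ENNReal.toReal_ofReal hℓ.le
      rw [hm, Real.sqrt_eq_rpow]
      simp

/-- The Volterra operator `(V η)(x) = ∫₀ˣ η`. -/
def volterra (hℓ : 0 < ℓ) : L2 ℓ →L[ℂ] L2 ℓ := (ofIcc hℓ).comp (primitive ℓ)

theorem isCompactOperator_volterra (hℓ : 0 < ℓ) : IsCompactOperator (volterra hℓ) :=
  (isCompactOperator_primitive ℓ).clm_comp (ofIcc hℓ)

theorem volterra_contFn (hℓ : 0 < ℓ) {f : ℝ → ℂ} (hf : Continuous f) :
    volterra hℓ (contFn ℓ f hf) =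
      contFn ℓ (fun x => ∫ t in (0)..x, f t) (intervalIntegral.continuous_primitive
        (fun _ _ => hf.intervalIntegrable _ _) 0) := by
  refine Lp.ext ?_
  refine ((memLp_extend hℓ _).coeFn_toLp).trans (EventuallyEq.trans ?_ (coeFn_contFn _).symm)
  refine (ae_restrict_iff' measurableSet_Ioo).2 (Eventually.of_forall fun x hx => ?_)
  rw [Set.IccExtend_of_mem _ _ (Set.Ioo_subset_Icc_self hx)]
  change ∫ t in Set.Ioc 0 x, contFn ℓ f hf t ∂μ ℓ = ∫ t in (0)..x, f t
  rw [intervalIntegral.integral_of_le hx.1.le,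
    integral_congr_ae (ae_restrict_of_ae (coeFn_contFn hf)), Measure.restrict_restrict
    measurableSet_Ioc, Set.inter_eq_left.2 (show Set.Ioc 0 x ⊆ Set.Ioo 0 ℓ from
      fun t ht => ⟨ht.1, ht.2.trans_lt hx.2⟩)]

/-- The claim is closed in `η`, so it suffices to treat the dense set of bounded continuous
functions, where it is the fundamental theorem of calculus. -/
theorem hasWeakDeriv_volterra (hℓ : 0 < ℓ) (η : L2 ℓ) : HasWeakDeriv ℓ 1 (volterra hℓ η) η := by
  have hd : DenseRange (BoundedContinuousFunction.toLp (E := ℂ) 2 (μ ℓ) ℂ) :=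
    BoundedContinuousFunction.toLp_denseRange ℂ (μ ℓ) ℂ (by norm_num)
  refine hd.induction_on (p := fun η => HasWeakDeriv ℓ 1 (volterra hℓ η) η) η ?_ fun f => ?_
  · exact (isClosed_setOf_hasWeakDeriv ℓ 1).preimage
      ((volterra hℓ).continuous.prodMk continuous_id)
  · have e : BoundedContinuousFunction.toLp (E := ℂ) 2 (μ ℓ) ℂ f = contFn ℓ f f.continuous := by
      refine Lp.ext ?_
      exact (BoundedContinuousFunction.coeFn_toLp (p := 2) (𝕜 := ℂ) (μ ℓ) f).trans
        (coeFn_contFn f.continuous).symm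
    rw [e, volterra_contFn]
    exact hasWeakDeriv_contFn hℓ (fun x => intervalIntegral.integral_hasDerivAt_right
      (f.continuous.intervalIntegrable _ _) (f.continuous.stronglyMeasurableAtFilter _ _)
      f.continuous.continuousAt) _ _

theorem HasWeakDeriv.exists_eq_volterra_add_const (hℓ : 0 < ℓ) {ξ η : L2 ℓ}
    (h : HasWeakDeriv ℓ 1 ξ η) :
    ∃ c : ℂ, ξ = volterra hℓ η + c • contFn ℓ (fun _ => 1) continuous_const := by
  have h1 := h.add ((hasWeakDeriv_volterra hℓ η).smul (-1))
  rw [neg_one_smul, neg_one_smul, add_neg_cancel] at h1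
  obtain ⟨c, hc⟩ := h1.exists_const_of_succ_zero hℓ
  refine ⟨c, ?_⟩
  have e : contFn ℓ (fun _ => c) continuous_const =
      c • contFn ℓ (fun _ => 1) continuous_const := by
    rw [contFn, contFn, ← MemLp.toLp_const_smul]
    congr 1
    ext x
    simp
  rw [← e, ← hc.eq_of_zero]
  abel

/-- A bounded operator with range in `W¹` is compact. -/
theorem isCompactOperator_of_range_subset_W (hℓ : 0 < ℓ) {R : L2 ℓ →L[ℂ] L2 ℓ}
    (h : ∀ y, ∃ η, HasWeakDeriv ℓ 1 (R y) η) : IsCompactOperator R := by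
  choose d hd using h
  let D : L2 ℓ →ₗ[ℂ] L2 ℓ :=
    { toFun := d
      map_add' := fun y z => (hd (y + z)).unique (by
        rw [map_add]; exact (hd y).add (hd z))
      map_smul' := fun c y => (hd (c • y)).unique (by
        rw [map_smul]; exact (hd y).smul c) }
  -- The closed graph theorem: the graph of `D` is a preimage of the closed weak derivative relation
  -- under a continuous map.
  have hD : Continuous D := by
    refine LinearMap.continuous_of_isClosed_graph D ?_
    have : (D.graph : Set (L2 ℓ × L2 ℓ)) = {z | HasWeakDeriv ℓ 1 (R z.1) z.2} := by
      ext ⟨y, z⟩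
      change z = d y ↔ HasWeakDeriv ℓ 1 (R y) z
      exact ⟨fun e => e ▸ hd y, fun e => e.unique (hd y)⟩
    rw [this]
    exact (isClosed_setOf_hasWeakDeriv ℓ 1).preimage (by fun_prop : Continuous
      fun z : L2 ℓ × L2 ℓ => (R z.1, z.2))
  let D' : L2 ℓ →L[ℂ] L2 ℓ := ⟨D, hD⟩
  set u : L2 ℓ := contFn ℓ (fun _ => 1) continuous_const
  -- Subtracting the primitive of the derivative leaves only constants, so `T` has finite rank.
  let T : L2 ℓ →L[ℂ] L2 ℓ := R - (volterra hℓ).comp D'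
  have hT : ∀ y, T y ∈ Submodule.span ℂ {u} := by
    intro y
    obtain ⟨c, hc⟩ := (hd y).exists_eq_volterra_add_const hℓ
    refine Submodule.mem_span_singleton.2 ⟨c, ?_⟩
    change c • u = R y - volterra hℓ (d y)
    rw [hc]
    abel
  have hTc : IsCompactOperator T := by
    have := FiniteDimensional.proper ℂ (Submodule.span ℂ {u})
    have h1 : IsCompactOperator (T.codRestrict _ hT) :=
      isCompactOperator_of_locallyCompactSpace_dom _
    exact h1.clm_comp (Submodule.span ℂ {u}).subtypeL
  have e : (R : L2 ℓ → L2 ℓ) = T + (volterra hℓ).comp D' := by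
    ext1 y
    change R y = R y - volterra hℓ (d y) + volterra hℓ (d y)
    abel
  rw [e]
  exact hTc.add ((isCompactOperator_volterra hℓ).comp_clm D')

end Volterra

/-! ### Polynomials as elements of `L²`. -/

/-- The class in `L²((0,ℓ))` of a polynomial. -/
def polyFn (ℓ : ℝ) : Polynomial ℂ →ₗ[ℂ] L2 ℓ where
  toFun p := contFn ℓ (fun x : ℝ => p.eval (x : ℂ)) (by fun_prop)
  map_add' p q := by
    simp only [contFn, ← MemLp.toLp_add]
    congr 1
    ext x
    simp
  map_smul' c p := by
    simp only [contFn, ← MemLp.toLp_const_smul]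
    congr 1
    ext x
    simp

theorem polyFn_apply (ℓ : ℝ) (p : Polynomial ℂ) :
    polyFn ℓ p = contFn ℓ (fun x : ℝ => p.eval (x : ℂ)) (by fun_prop) := rfl

theorem polyFn_injective {ℓ : ℝ} (hℓ : 0 < ℓ) : Function.Injective (polyFn ℓ) := by
  intro p q h
  have h1 := eqOn_of_contFn_eq (f := fun x : ℝ => p.eval (x : ℂ))
    (g := fun x : ℝ => q.eval (x : ℂ)) (hf := by fun_prop) (hg := by fun_prop) h
  refine Polynomial.eq_of_infinite_eval_eq p q ?_
  refine ((Set.Ioo_infinite hℓ).image Complex.ofReal_injective.injOn).mono ?_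
  rintro _ ⟨x, hx, rfl⟩
  exact h1 hx

/-- `L²((0,ℓ))` is infinite dimensional. -/
theorem not_finiteDimensional_L2 {ℓ : ℝ} (hℓ : 0 < ℓ) : ¬ FiniteDimensional ℂ (L2 ℓ) := by
  intro hfin
  exact Polynomial.not_finite (Module.Finite.of_injective (polyFn ℓ) (polyFn_injective hℓ))

/-! ### Smooth functions and polynomials in the domain -/

section Kernel

variable {ℓ : ℝ}

theorem hasDerivAt_iteratedDeriv {f : ℝ → ℂ} (hf : ContDiff ℝ ∞ f) (k : ℕ) (x : ℝ) :
    HasDerivAt (iteratedDeriv k f) (iteratedDeriv (k + 1) f x) x := by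
  rw [iteratedDeriv_succ]
  exact (hf.differentiable_iteratedDeriv k
    (by exact_mod_cast WithTop.coe_lt_top _)).differentiableAt.hasDerivAt

theorem continuous_iteratedDeriv {f : ℝ → ℂ} (hf : ContDiff ℝ ∞ f) (k : ℕ) :
    Continuous (iteratedDeriv k f) :=
  hf.continuous_iteratedDeriv k (by exact_mod_cast le_top)

theorem hasWeakDeriv_iteratedDeriv (hℓ : 0 < ℓ) {f : ℝ → ℂ} (hf : ContDiff ℝ ∞ f) (k : ℕ) :
    HasWeakDeriv ℓ k (contFn ℓ f hf.continuous)
      (contFn ℓ (iteratedDeriv k f) (continuous_iteratedDeriv hf k)) := by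
  induction k with
  | zero => simpa only [iteratedDeriv_zero] using HasWeakDeriv.self _
  | succ k ih => exact ih.trans (hasWeakDeriv_contFn hℓ (hasDerivAt_iteratedDeriv hf k) _ _)

theorem mem_graph_productOp_contFn (hℓ : 0 < ℓ) (S : Support) {f : ℝ → ℂ} (hf : ContDiff ℝ ∞ f)
    (h0 : ∀ k ∈ S.left, iteratedDeriv k f 0 = 0) (h1 : ∀ k ∈ S.right, iteratedDeriv k f ℓ = 0) :
    (contFn ℓ f hf.continuous, contFn ℓ (iteratedDeriv 4 f) (continuous_iteratedDeriv hf 4)) ∈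
      (productOp ℓ S).graph := by
  rw [mem_graph_productOp]
  refine ⟨fun s _ => ⟨_, hasWeakDeriv_iteratedDeriv hℓ hf s⟩,
    fun k _ => ⟨fun hk => ?_, fun hk => ?_⟩, hasWeakDeriv_iteratedDeriv hℓ hf 4⟩
  · exact ⟨_, hasWeakDeriv_iteratedDeriv hℓ hf k, vanishesAt_contFn _ (h0 k hk)⟩
  · exact ⟨_, hasWeakDeriv_iteratedDeriv hℓ hf k, vanishesAt_contFn _ (h1 k hk)⟩

open Polynomial in
theorem hasDerivAt_eval_ofReal (p : ℂ[X]) (x : ℝ) :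
    HasDerivAt (fun x : ℝ => p.eval (x : ℂ)) ((derivative p).eval (x : ℂ)) x :=
  (p.hasDerivAt (x : ℂ)).comp_ofReal

open Polynomial in
theorem contDiff_eval_ofReal (p : ℂ[X]) : ContDiff ℝ ∞ (fun x : ℝ => p.eval (x : ℂ)) := by
  have h : ContDiff ℂ ∞ (fun z : ℂ => p.eval z) := by
    simpa only [aeval_def, eval₂_eq_eval_map, Algebra.algebraMap_self, Polynomial.map_id]
      using p.contDiff_aeval (𝕜 := ℂ) ∞
  exact (h.restrict_scalars ℝ).comp Complex.ofRealCLM.contDiff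

open Polynomial in
theorem iteratedDeriv_eval_ofReal (p : ℂ[X]) (k : ℕ) :
    iteratedDeriv k (fun x : ℝ => p.eval (x : ℂ)) =
      fun x : ℝ => (derivative^[k] p).eval (x : ℂ) := by
  induction k with
  | zero => simp
  | succ k ih =>
    rw [iteratedDeriv_succ, ih, Function.iterate_succ_apply']
    exact funext fun x => (hasDerivAt_eval_ofReal _ x).deriv

open Polynomial in
theorem hasWeakDeriv_polyFn (hℓ : 0 < ℓ) (p : ℂ[X]) (k : ℕ) :
    HasWeakDeriv ℓ k (polyFn ℓ p) (polyFn ℓ (derivative^[k] p)) := by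
  have := hasWeakDeriv_iteratedDeriv hℓ (contDiff_eval_ofReal p) k
  simp only [iteratedDeriv_eval_ofReal] at this
  exact this

open Polynomial in
theorem HasWeakDeriv.exists_polyFn (hℓ : 0 < ℓ) {s : ℕ} {ξ : L2 ℓ} (h : HasWeakDeriv ℓ s ξ 0) :
    ∃ p : ℂ[X], p.degree < s ∧ ξ = polyFn ℓ p := by
  induction s generalizing ξ with
  | zero => exact ⟨0, by simp, by rw [h.eq_of_zero, map_zero]⟩
  | succ s ih =>
    obtain ⟨c, hc⟩ := h.exists_const_of_succ_zero hℓ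
    have hs : (s.factorial : ℂ) ≠ 0 := by exact_mod_cast s.factorial_ne_zero
    have h1 := hasWeakDeriv_polyFn hℓ (X ^ s) s
    rw [iterate_derivative_X_pow_eq_smul, Nat.sub_self, pow_zero, Nat.descFactorial_self] at h1
    -- The `s`-th derivative of `ξ` is the constant `c`, and so is that of `(c / s!) x ^ s`; the
    -- difference falls under the induction hypothesis.
    have h2 := hc.add (h1.smul (-(c / s.factorial)))
    have e : contFn ℓ (fun _ => c) continuous_const = polyFn ℓ (c • 1) := by
      rw [polyFn_apply]
      congr 1
      ext x
      simp
    rw [← map_smul, ← map_smul, smul_smul, neg_mul, div_mul_cancel₀ _ hs, e, ← map_add, neg_smul,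
      ← add_smul, add_neg_cancel, zero_smul, map_zero] at h2
    obtain ⟨p, hp, hξ⟩ := ih h2
    refine ⟨p + (c / s.factorial) • X ^ s, ?_, ?_⟩
    · refine (degree_add_le _ _).trans_lt (max_lt (hp.trans (by exact_mod_cast s.lt_succ_self)) ?_)
      refine (degree_smul_le _ _).trans_lt ?_
      rw [degree_X_pow]
      exact_mod_cast s.lt_succ_self
    · rw [map_add, ← hξ, map_neg]
      abel

theorem VanishesAt.eval_eq_zero (hℓ : 0 < ℓ) {p : Polynomial ℂ} {x : ℝ} (hx : x ∈ Set.Icc 0 ℓ)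
    (h : VanishesAt ℓ (polyFn ℓ p) x) : p.eval (x : ℂ) = 0 :=
  VanishesAt.apply_eq_zero (f := fun x : ℝ => p.eval (x : ℂ)) (hf := by fun_prop) hℓ hx h

open Polynomial in
theorem DerivVanishesAt.eval_eq_zero (hℓ : 0 < ℓ) {p : ℂ[X]} {x : ℝ} (hx : x ∈ Set.Icc 0 ℓ)
    {k : ℕ} (h : DerivVanishesAt ℓ k (polyFn ℓ p) x) : (derivative^[k] p).eval (x : ℂ) = 0 := by
  obtain ⟨η, h1, h2⟩ := h
  rw [h1.unique (hasWeakDeriv_polyFn hℓ p k)] at h2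
  exact h2.eval_eq_zero hℓ hx

/-- A smooth function that agrees with `g` near `x` and with `0` near `y`. -/
theorem exists_contDiff_eventuallyEq {x y : ℝ} (hxy : x ≠ y) {g : ℝ → ℂ} (hg : ContDiff ℝ ∞ g) :
    ∃ f : ℝ → ℂ, ContDiff ℝ ∞ f ∧ f =ᶠ[𝓝 x] g ∧ f =ᶠ[𝓝 y] 0 := by
  have hd : 0 < |x - y| := abs_pos.2 (sub_ne_zero.2 hxy)
  -- The outer radius is half the distance, so the bump vanishes on the ball of that radius about
  -- `y`.
  let χ : ContDiffBump x := ⟨|x - y| / 4, |x - y| / 2, by positivity, by linarith⟩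
  refine ⟨fun t => (χ t : ℂ) * g t, (Complex.ofRealCLM.contDiff.comp χ.contDiff).mul hg, ?_, ?_⟩
  · filter_upwards [χ.eventuallyEq_one] with t ht
    simp [ht]
  · have : Metric.ball y (|x - y| / 2) ∈ 𝓝 y := Metric.ball_mem_nhds _ (by positivity)
    filter_upwards [this] with t ht
    have h0 : χ t = 0 := by
      refine χ.zero_of_le_dist ?_
      rw [Metric.mem_ball, Real.dist_eq] at ht
      rw [Real.dist_eq]
      change |x - y| / 2 ≤ |t - x|
      have := abs_sub_le x t y
      rw [abs_sub_comm x t] at this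
      linarith
    simp [h0]

open Polynomial in
/-- Green's formula, for a smooth function against a polynomial of degree at most `3`. -/
theorem inner_iteratedDeriv_polyFn (hℓ : 0 < ℓ) {f : ℝ → ℂ} (hf : ContDiff ℝ ∞ f) {p : ℂ[X]}
    (hp : derivative^[4] p = 0) {B : ℝ → ℂ}
    (hB : B = fun x : ℝ => conj (iteratedDeriv 3 f x) * p.eval (x : ℂ) -
      conj (iteratedDeriv 2 f x) * (derivative^[1] p).eval (x : ℂ) +
      conj (iteratedDeriv 1 f x) * (derivative^[2] p).eval (x : ℂ) -
      conj (iteratedDeriv 0 f x) * (derivative^[3] p).eval (x : ℂ)) :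
    inner ℂ (contFn ℓ (iteratedDeriv 4 f) (continuous_iteratedDeriv hf 4)) (polyFn ℓ p) =
      B ℓ - B 0 := by
  rw [polyFn_apply, inner_contFn_contFn, setIntegral_Ioo_eq_intervalIntegral hℓ]
  refine intervalIntegral.integral_eq_sub_of_hasDerivAt (fun x _ => ?_) ?_
  · have hd : ∀ k, HasDerivAt (fun x => conj (iteratedDeriv k f x))
        (conj (iteratedDeriv (k + 1) f x)) x := fun k => (hasDerivAt_iteratedDeriv hf k x).star
    have hq : ∀ k, HasDerivAt (fun x : ℝ => (derivative^[k] p).eval (x : ℂ))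
        ((derivative^[k + 1] p).eval (x : ℂ)) x := fun k => by
      rw [Function.iterate_succ_apply']
      exact hasDerivAt_eval_ofReal _ x
    -- The derivative of `B` telescopes to `conj f'''' * p`, the last term vanishing because `p''''
    -- = 0`.
    have := ((((hd 3).mul (hq 0)).sub ((hd 2).mul (hq 1))).add ((hd 1).mul (hq 2))).sub
      ((hd 0).mul (hq 3))
    rw [hB]
    refine this.congr_deriv ?_
    simp only [Nat.reduceAdd, Function.iterate_zero, id_eq, hp, eval_zero]
    ring
  · refine Continuous.intervalIntegrable ?_ _ _
    exact (Complex.continuous_conj.comp (continuous_iteratedDeriv hf 4)).mul (by fun_prop)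

open Polynomial in
-- Two integrations by parts of `∫ |p''|²`, with `p'''' = 0`. Each boundary term pairs `p` with
-- `p'''` or `p'` with `p''`, that is, a possibly imposed condition with its complementary one.
theorem inner_polyFn_derivative_two (hℓ : 0 < ℓ) {p : ℂ[X]} (hp : derivative^[4] p = 0) {B : ℝ → ℂ}
    (hB : B = fun x : ℝ => conj ((derivative^[2] p).eval (x : ℂ)) *
        (derivative^[1] p).eval (x : ℂ) -
      conj ((derivative^[3] p).eval (x : ℂ)) * p.eval (x : ℂ)) :
    inner ℂ (polyFn ℓ (derivative^[2] p)) (polyFn ℓ (derivative^[2] p)) = B ℓ - B 0 := by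
  rw [polyFn_apply, inner_contFn_contFn, setIntegral_Ioo_eq_intervalIntegral hℓ]
  refine intervalIntegral.integral_eq_sub_of_hasDerivAt (fun x _ => ?_) ?_
  · have hq : ∀ k, HasDerivAt (fun x : ℝ => (derivative^[k] p).eval (x : ℂ))
        ((derivative^[k + 1] p).eval (x : ℂ)) x := fun k => by
      rw [Function.iterate_succ_apply']
      exact hasDerivAt_eval_ofReal _ x
    have := ((hq 2).star.mul (hq 1)).sub ((hq 3).star.mul (hq 0))
    rw [hB]
    refine this.congr_deriv ?_
    simp only [Nat.reduceAdd, Function.iterate_zero, id_eq, hp, eval_zero, star_zero,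
      starRingEnd_apply]
    ring
  · refine Continuous.intervalIntegrable ?_ _ _
    exact (Complex.continuous_conj.comp (by fun_prop)).mul (by fun_prop)

open Polynomial in
theorem exists_eq_linear_of_derivative_two_eq_zero {p : ℂ[X]} (h : derivative^[2] p = 0) :
    ∃ a b : ℂ, p = C a + C b * X := by
  have h1 : derivative (derivative p) = 0 := h
  have h2 := eq_C_of_derivative_eq_zero h1
  set b := (derivative p).coeff 0
  have h3 : derivative (p - C b * X) = 0 := by
    rw [derivative_sub, h2, derivative_C_mul_X, sub_self]
  have h4 := eq_C_of_derivative_eq_zero h3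
  exact ⟨_, b, by rw [← h4]; ring⟩

open Polynomial in
theorem linearFn_eq_polyFn (a b : ℂ) : linearFn ℓ a b = polyFn ℓ (C a + C b * X) := by
  rw [linearFn_eq_contFn, polyFn_apply]
  congr 1
  ext x
  simp

end Kernel

/-! ### The kernel of the beam operator -/

section BeamOperator

open Polynomial

variable {ℓ : ℝ} {S : Support} {A : L2 ℓ →ₗ.[ℂ] L2 ℓ}

/-- The conditions put `f` in `dom Â ⊆ dom A`, where `A f = f''''`; symmetry moves `A` onto `ξ`,
which it annihilates. -/
theorem IsBeamOperator.inner_iteratedDeriv_eq_zero (hℓ : 0 < ℓ) (hA : IsBeamOperator ℓ S A)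
    {ξ : L2 ℓ} (hξ : ξ ∈ eigenspace A 0) {f : ℝ → ℂ} (hf : ContDiff ℝ ∞ f)
    (h0 : ∀ k ∈ S.left, iteratedDeriv k f 0 = 0) (h1 : ∀ k ∈ S.right, iteratedDeriv k f ℓ = 0) :
    inner ℂ (contFn ℓ (iteratedDeriv 4 f) (continuous_iteratedDeriv hf 4)) ξ = 0 := by
  have hg := LinearPMap.le_graph_of_le hA.extends_productOp
    (mem_graph_productOp_contFn hℓ S hf h0 h1)
  obtain ⟨x, -, hx⟩ := (LinearPMap.mem_graph_iff _).1 hg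
  obtain ⟨h2, h3⟩ := (mem_eigenspace _ _ _).1 hξ
  simp only at hx
  rw [← hx, inner_apply_left_of_isSelfAdjoint hA.selfAdjoint x ⟨ξ, h2⟩, h3, zero_smul,
    inner_zero_right]

theorem IsBeamOperator.hasWeakDeriv_four_of_mem_ker (hℓ : 0 < ℓ) (hA : IsBeamOperator ℓ S A)
    {ξ : L2 ℓ} (hξ : ξ ∈ eigenspace A 0) : HasWeakDeriv ℓ 4 ξ 0 := by
  rw [hasWeakDeriv_iff_inner]
  intro φ hφ
  have h := hA.inner_iteratedDeriv_eq_zero hℓ hξ hφ.1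
    (fun k _ => (hφ.iteratedDeriv k).apply_eq_zero (by simp))
    (fun k _ => (hφ.iteratedDeriv k).apply_eq_zero (by simp))
  rw [inner_zero_left, ← inner_conj_symm, h, map_zero, mul_zero]

theorem iteratedDeriv_linear (e : ℝ) (α β : ℂ) (k : ℕ) :
    iteratedDeriv k (fun x : ℝ => (C α + C β * (X - C (e : ℂ))).eval (x : ℂ)) e =
      if k = 0 then α else if k = 1 then β else 0 := by
  rw [iteratedDeriv_eval_ofReal]
  match k with
  | 0 => simp
  | 1 => simp
  | k + 2 =>
    have : derivative^[k + 2] (C α + C β * (X - C (e : ℂ))) = 0 := by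
      rw [Function.iterate_add_apply]
      simp
    simp [this]

/-- The boundary conditions of orders `2` and `3` hold for polynomials in the kernel. -/
theorem IsBeamOperator.natural_conditions (hℓ : 0 < ℓ) (hA : IsBeamOperator ℓ S A) {p : ℂ[X]}
    (hp : derivative^[4] p = 0) (hξ : polyFn ℓ p ∈ eigenspace A 0) :
    ((0 ∉ S.left → (derivative^[3] p).eval 0 = 0) ∧
      (1 ∉ S.left → (derivative^[2] p).eval 0 = 0)) ∧
    ((0 ∉ S.right → (derivative^[3] p).eval (ℓ : ℂ) = 0) ∧
      (1 ∉ S.right → (derivative^[2] p).eval (ℓ : ℂ) = 0)) := by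
  -- Take `f` equal to `α + β x` near `0` and to zero near `ℓ`. Its derivatives of order at least 2
  -- vanish at both ends, so only the conditions of orders 0 and 1 at `0` restrict `α` and `β`.
  have hl : ∀ α β : ℂ, (0 ∈ S.left → α = 0) → (1 ∈ S.left → β = 0) →
      conj β * (derivative^[2] p).eval 0 = conj α * (derivative^[3] p).eval 0 := by
    intro α β hα hβ
    obtain ⟨f, hf, hf0, hf1⟩ := exists_contDiff_eventuallyEq hℓ.ne
      (contDiff_eval_ofReal (C α + C β * (X - C ((0 : ℝ) : ℂ))))
    have e0 : ∀ k, iteratedDeriv k f 0 = if k = 0 then α else if k = 1 then β else 0 := fun k => by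
      rw [hf0.iteratedDeriv_eq k, iteratedDeriv_linear]
    have e1 : ∀ k, iteratedDeriv k f ℓ = 0 := fun k => by
      rw [hf1.iteratedDeriv_eq k, iteratedDeriv_const_zero]
    have h := hA.inner_iteratedDeriv_eq_zero hℓ hξ hf (fun k hk => by
      rw [e0]
      split_ifs with h h
      · exact hα (h ▸ hk)
      · exact hβ (h ▸ hk)
      · rfl) (fun k _ => e1 k)
    rw [inner_iteratedDeriv_polyFn hℓ hf hp rfl] at h
    simp only [e0, e1, reduceIte, OfNat.ofNat_ne_zero, OfNat.ofNat_ne_one, one_ne_zero, map_zero,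
      zero_mul, Complex.ofReal_zero] at h
    linear_combination -h
  have hr : ∀ α β : ℂ, (0 ∈ S.right → α = 0) → (1 ∈ S.right → β = 0) →
      conj β * (derivative^[2] p).eval (ℓ : ℂ) = conj α * (derivative^[3] p).eval (ℓ : ℂ) := by
    intro α β hα hβ
    obtain ⟨f, hf, hf0, hf1⟩ := exists_contDiff_eventuallyEq hℓ.ne'
      (contDiff_eval_ofReal (C α + C β * (X - C (ℓ : ℂ))))
    have e0 : ∀ k, iteratedDeriv k f ℓ = if k = 0 then α else if k = 1 then β else 0 := fun k => by
      rw [hf0.iteratedDeriv_eq k, iteratedDeriv_linear]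
    have e1 : ∀ k, iteratedDeriv k f 0 = 0 := fun k => by
      rw [hf1.iteratedDeriv_eq k, iteratedDeriv_const_zero]
    have h := hA.inner_iteratedDeriv_eq_zero hℓ hξ hf (fun k _ => e1 k) (fun k hk => by
      rw [e0]
      split_ifs with h h
      · exact hα (h ▸ hk)
      · exact hβ (h ▸ hk)
      · rfl)
    rw [inner_iteratedDeriv_polyFn hℓ hf hp rfl] at h
    simp only [e0, e1, reduceIte, OfNat.ofNat_ne_zero, OfNat.ofNat_ne_one, one_ne_zero, map_zero,
      zero_mul, Complex.ofReal_zero] at h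
    linear_combination h
  -- Setting one of `α`, `β` to 1 where it is free, and the other to 0, isolates one derivative of
  -- `p`.
  refine ⟨⟨fun h => ?_, fun h => ?_⟩, ⟨fun h => ?_, fun h => ?_⟩⟩
  · simpa using (hl 1 0 (fun h' => absurd h' h) (fun _ => rfl)).symm
  · simpa using hl 0 1 (fun _ => rfl) (fun h' => absurd h' h)
  · simpa using (hr 1 0 (fun h' => absurd h' h) (fun _ => rfl)).symm
  · simpa using hr 0 1 (fun _ => rfl) (fun h' => absurd h' h)

/-- In each boundary product of `∫ |p''|²` one factor vanishes, either by an imposed condition or by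
a natural one, so `p'' = 0`. Conversely, a linear function meets the conditions of orders 2 and 3
for free, so those of orders 0 and 1 already put it in `dom Â`. -/
theorem IsBeamOperator.mem_ker_iff (hℓ : 0 < ℓ) (hA : IsBeamOperator ℓ S A) (ξ : L2 ℓ) :
    ξ ∈ eigenspace A 0 ↔ ∃ a b : ℂ, ξ = linearFn ℓ a b ∧ (0 ∈ S.left → a = 0) ∧
      (1 ∈ S.left → b = 0) ∧ (0 ∈ S.right → a + b * ℓ = 0) ∧ (1 ∈ S.right → b = 0) := by
  have m0 : (0 : ℝ) ∈ Set.Icc 0 ℓ := ⟨le_rfl, hℓ.le⟩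
  have m1 : ℓ ∈ Set.Icc 0 ℓ := ⟨hℓ.le, le_rfl⟩
  constructor
  · intro hξ
    obtain ⟨p, hdeg, rfl⟩ := (hA.hasWeakDeriv_four_of_mem_ker hℓ hξ).exists_polyFn hℓ
    have hp : derivative^[4] p = 0 := iterate_derivative_eq_zero_of_degree_lt hdeg
    have hdom := hA.domain_subset ((mem_eigenspace _ _ _).1 hξ).1
    obtain ⟨l0, r0⟩ := hdom.2 0 (by norm_num)
    obtain ⟨l1, r1⟩ := hdom.2 1 (by norm_num)
    replace l0 := fun h => (l0 h).eval_eq_zero hℓ m0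
    replace l1 := fun h => (l1 h).eval_eq_zero hℓ m0
    replace r0 := fun h => (r0 h).eval_eq_zero hℓ m1
    replace r1 := fun h => (r1 h).eval_eq_zero hℓ m1
    simp only [Complex.ofReal_zero, Function.iterate_zero, id_eq] at l0 l1 r0 r1
    obtain ⟨⟨l3, l2⟩, r3, r2⟩ := hA.natural_conditions hℓ hp hξ
    have hz : derivative^[2] p = 0 := by
      refine polyFn_injective hℓ ?_
      rw [map_zero, ← inner_self_eq_zero (𝕜 := ℂ), inner_polyFn_derivative_two hℓ hp rfl]
      simp only [Complex.ofReal_zero]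
      have c1 : conj ((derivative^[2] p).eval (ℓ : ℂ)) * (derivative^[1] p).eval (ℓ : ℂ) = 0 := by
        by_cases h : 1 ∈ S.right
        · rw [r1 h, mul_zero]
        · rw [r2 h, map_zero, zero_mul]
      have c2 : conj ((derivative^[3] p).eval (ℓ : ℂ)) * p.eval (ℓ : ℂ) = 0 := by
        by_cases h : 0 ∈ S.right
        · rw [r0 h, mul_zero]
        · rw [r3 h, map_zero, zero_mul]
      have c3 : conj ((derivative^[2] p).eval 0) * (derivative^[1] p).eval 0 = 0 := by
        by_cases h : 1 ∈ S.left
        · rw [l1 h, mul_zero]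
        · rw [l2 h, map_zero, zero_mul]
      have c4 : conj ((derivative^[3] p).eval 0) * p.eval 0 = 0 := by
        by_cases h : 0 ∈ S.left
        · rw [l0 h, mul_zero]
        · rw [l3 h, map_zero, zero_mul]
      rw [c1, c2, c3, c4, sub_self]
    obtain ⟨a, b, rfl⟩ := exists_eq_linear_of_derivative_two_eq_zero hz
    refine ⟨a, b, (linearFn_eq_polyFn a b).symm, fun h => ?_, fun h => ?_, fun h => ?_, fun h => ?_⟩
    · simpa using l0 h
    · simpa using l1 h
    · simpa using r0 h
    · simpa using r1 h
  · rintro ⟨a, b, rfl, l0, l1, r0, r1⟩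
    have hi : ∀ k, derivative^[k + 2] (C a + C b * X) = 0 := fun k => by
      rw [Function.iterate_add_apply]
      simp
    have hg := mem_graph_productOp_contFn hℓ S (contDiff_eval_ofReal (C a + C b * X))
      (fun k hk => by
        rw [iteratedDeriv_eval_ofReal]
        match k with
        | 0 => simpa using l0 hk
        | 1 => simpa using l1 hk
        | k + 2 => simp only [hi, eval_zero])
      (fun k hk => by
        rw [iteratedDeriv_eval_ofReal]
        match k with
        | 0 => simpa using r0 hk
        | 1 => simpa using r1 hk
        | k + 2 => simp only [hi, eval_zero])
    obtain ⟨x, hx, hx'⟩ := (LinearPMap.mem_graph_iff _).1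
      (LinearPMap.le_graph_of_le hA.extends_productOp hg)
    simp only [iteratedDeriv_eval_ofReal, hi 2] at hx hx'
    rw [mem_eigenspace, linearFn_eq_polyFn, polyFn_apply, ← hx]
    refine ⟨x.2, ?_⟩
    rw [zero_smul, hx']
    simpa [polyFn_apply] using (polyFn ℓ).map_zero

theorem linearFn_eq_smul_add_smul (a b : ℂ) :
    linearFn ℓ a b = a • linearFn ℓ 1 0 + b • linearFn ℓ 0 1 := by
  simp only [linearFn_eq_polyFn, ← map_smul, ← map_add]
  congr 1
  simp [smul_eq_C_mul]

theorem linearFn_injective (hℓ : 0 < ℓ) {a b a' b' : ℂ} (h : linearFn ℓ a b = linearFn ℓ a' b') :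
    a = a' ∧ b = b' := by
  rw [linearFn_eq_polyFn, linearFn_eq_polyFn] at h
  have h' := polyFn_injective hℓ h
  have h0 := congrArg (fun p => p.coeff 0) h'
  have h1 := congrArg (fun p => p.coeff 1) h'
  simp [coeff_C] at h0 h1
  exact ⟨h0, h1⟩

theorem linearFn_ne_zero (hℓ : 0 < ℓ) {a b : ℂ} (h : a ≠ 0 ∨ b ≠ 0) : linearFn ℓ a b ≠ 0 := by
  intro h0
  have hz : linearFn ℓ 0 0 = 0 := by simp [linearFn_eq_polyFn]
  obtain ⟨rfl, rfl⟩ := linearFn_injective hℓ (h0.trans hz.symm)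
  simp at h

theorem IsBeamOperator.ker_flexible_free (hℓ : 0 < ℓ)
    (hA : IsBeamOperator ℓ (.ends .flexible .free) A) :
    eigenspace A 0 = Submodule.span ℂ {linearFn ℓ 0 1} := by
  ext ξ
  rw [hA.mem_ker_iff hℓ, Submodule.mem_span_singleton]
  simp only [Support.left, Support.right, EndSupport.orders]
  constructor
  · rintro ⟨a, b, rfl, ha, -⟩
    refine ⟨b, ?_⟩
    rw [ha (by simp), linearFn_eq_smul_add_smul 0 b, zero_smul, zero_add]
  · rintro ⟨b, rfl⟩
    exact ⟨0, b, by rw [linearFn_eq_smul_add_smul 0 b, zero_smul, zero_add], by simp⟩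

theorem IsBeamOperator.ker_free_flexible (hℓ : 0 < ℓ)
    (hA : IsBeamOperator ℓ (.ends .free .flexible) A) :
    eigenspace A 0 = Submodule.span ℂ {linearFn ℓ ℓ (-1)} := by
  -- The kernel condition reads `a = -b ℓ`; the double negation exhibits this shape with `b = -c`.
  have e : ∀ c : ℂ, c • linearFn ℓ ℓ (-1) = linearFn ℓ (-(-c) * ℓ) (-c) := fun c => by
    rw [linearFn_eq_smul_add_smul, smul_add, smul_smul, smul_smul,
      linearFn_eq_smul_add_smul (-(-c) * ℓ), neg_neg, mul_neg_one]
  ext ξ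
  rw [hA.mem_ker_iff hℓ, Submodule.mem_span_singleton]
  simp only [Support.left, Support.right, EndSupport.orders]
  constructor
  · rintro ⟨a, b, rfl, -, -, ha, -⟩
    refine ⟨-b, ?_⟩
    rw [e, neg_neg, neg_mul, ← eq_neg_of_add_eq_zero_left (ha (by simp)), neg_neg]
  · rintro ⟨c, rfl⟩
    exact ⟨_, _, e c, by simp⟩

theorem IsBeamOperator.ker_free_free (hℓ : 0 < ℓ)
    (hA : IsBeamOperator ℓ (.ends .free .free) A) :
    eigenspace A 0 = Submodule.span ℂ {linearFn ℓ 1 0, linearFn ℓ 0 1} := by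
  ext ξ
  rw [hA.mem_ker_iff hℓ, Submodule.mem_span_pair]
  simp only [Support.left, Support.right, EndSupport.orders]
  constructor
  · rintro ⟨a, b, rfl, -⟩
    exact ⟨a, b, (linearFn_eq_smul_add_smul a b).symm⟩
  · rintro ⟨a, b, rfl⟩
    exact ⟨a, b, (linearFn_eq_smul_add_smul a b).symm, by simp⟩

theorem IsBeamOperator.ker_addI (hℓ : 0 < ℓ) (hA : IsBeamOperator ℓ .addI A) :
    eigenspace A 0 = Submodule.span ℂ {linearFn ℓ 1 0} := by
  ext ξ
  rw [hA.mem_ker_iff hℓ, Submodule.mem_span_singleton]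
  simp only [Support.left, Support.right]
  constructor
  · rintro ⟨a, b, rfl, -, hb, -⟩
    refine ⟨a, ?_⟩
    rw [hb (by simp), linearFn_eq_smul_add_smul a 0, zero_smul, add_zero]
  · rintro ⟨a, rfl⟩
    exact ⟨a, 0, by rw [linearFn_eq_smul_add_smul a 0, zero_smul, add_zero], by simp⟩

theorem finrank_span_linearFn_pair (hℓ : 0 < ℓ) :
    Module.finrank ℂ (Submodule.span ℂ {linearFn ℓ 1 0, linearFn ℓ 0 1}) = 2 := by
  have hli : LinearIndependent ℂ ![linearFn ℓ 1 0, linearFn ℓ 0 1] := by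
    rw [LinearIndependent.pair_iff]
    intro s t h
    rw [← linearFn_eq_smul_add_smul] at h
    by_contra hne
    exact linearFn_ne_zero hℓ (by tauto) h
  have := finrank_span_eq_card hli
  rwa [Matrix.range_cons, Matrix.range_cons, Matrix.range_empty, Set.union_empty,
    Set.singleton_union, Fintype.card_fin] at this

theorem IsBeamOperator.zero_mem_pointSpectrum_iff (hℓ : 0 < ℓ) (hA : IsBeamOperator ℓ S A) :
    (0 : ℂ) ∈ pointSpectrum A ↔
      S = .ends .flexible .free ∨ S = .ends .free .flexible ∨ S = .ends .free .free ∨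
        S = .addI := by
  have hℓ' : (ℓ : ℂ) ≠ 0 := by exact_mod_cast hℓ.ne'
  constructor
  · intro h
    obtain ⟨ξ, hξ, hne⟩ := Submodule.exists_mem_ne_zero_of_ne_bot h
    obtain ⟨a, b, rfl, l0, l1, r0, r1⟩ := (hA.mem_ker_iff hℓ ξ).1 hξ
    have hab : ¬ (a = 0 ∧ b = 0) := by
      rintro ⟨rfl, rfl⟩
      exact hne (by simp [linearFn_eq_polyFn])
    -- Of the twelve cases, all but the four listed have enough conditions of orders 0 and 1 to
    -- force `a = b = 0`; `ℓ ≠ 0` is needed when both end values vanish.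
    rcases S with ⟨l | l | l, r | r | r⟩ | _ | _ | _ <;>
      simp [Support.left, Support.right, EndSupport.orders] at l0 l1 r0 r1 ⊢ <;>
      refine hab ?_ <;> simp_all
  · intro h
    rw [pointSpectrum, Set.mem_ofPred_eq, Submodule.ne_bot_iff]
    rcases h with rfl | rfl | rfl | rfl
    · exact ⟨_, by rw [hA.ker_flexible_free hℓ]; exact Submodule.mem_span_singleton_self _,
        linearFn_ne_zero hℓ (by simp)⟩
    · exact ⟨_, by rw [hA.ker_free_flexible hℓ]; exact Submodule.mem_span_singleton_self _,
        linearFn_ne_zero hℓ (by simp)⟩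
    · exact ⟨_, by rw [hA.ker_free_free hℓ]; exact Submodule.subset_span (Set.mem_insert _ _),
        linearFn_ne_zero hℓ (by simp)⟩
    · exact ⟨_, by rw [hA.ker_addI hℓ]; exact Submodule.mem_span_singleton_self _,
        linearFn_ne_zero hℓ (by simp)⟩

/-- Compactness needs only one weak derivative in the domain of `A`; the boundary conditions play no
role. -/
theorem IsBeamOperator.isCompactOperator (hℓ : 0 < ℓ) (hA : IsBeamOperator ℓ S A)
    {R : L2 ℓ →L[ℂ] L2 ℓ} (hR : IsInverseAddOne A R) : IsCompactOperator R :=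
  isCompactOperator_of_range_subset_W hℓ fun y =>
    (hA.domain_subset (hR.mem_domain y)).1 1 (by norm_num)

end BeamOperator

end Beam

end

/-! ### The main theorem, combining compact resolvent and kernel. -/

theorem mainTheorem2 (ℓ : ℝ) (hℓ : 0 < ℓ) (S : Beam.Support)
    (A : Beam.L2 ℓ →ₗ.[ℂ] Beam.L2 ℓ) (hA : Beam.IsBeamOperator ℓ S A) :
    -- the spectrum is a pure point spectrum contained in `[0, ∞)`
    (Beam.spectrum A = Beam.pointSpectrum A ∧
      ∀ z ∈ Beam.spectrum A, ∃ r : ℝ, 0 ≤ r ∧ z = (r : ℂ)) ∧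
    -- eigenspaces are finite dimensional
    (∀ z : ℂ, FiniteDimensional ℂ (Beam.eigenspace A z)) ∧
    -- orthonormal basis of eigenvectors; the eigenvalues, repeated according to multiplicity,
    -- increase and tend to infinity
    (∃ (ψ : HilbertBasis ℕ ℂ (Beam.L2 ℓ)) (a : ℕ → ℝ),
      (∀ n, ∃ h : ψ n ∈ A.domain, A ⟨ψ n, h⟩ = (a n : ℂ) • ψ n) ∧
      (∀ n, 0 ≤ a n) ∧ Monotone a ∧ Tendsto a atTop atTop ∧
      Beam.pointSpectrum A = Set.range (fun n => (a n : ℂ)) ∧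
      ∀ z : ℂ, {n | (a n : ℂ) = z}.Finite ∧
        {n | (a n : ℂ) = z}.ncard = Module.finrank ℂ (Beam.eigenspace A z)) ∧
    -- the eigenvalue zero
    ((0 : ℂ) ∈ Beam.pointSpectrum A ↔
      S = .ends .flexible .free ∨ S = .ends .free .flexible ∨ S = .ends .free .free ∨ S = .addI) ∧
    (S = .ends .flexible .free →
      Beam.eigenspace A 0 = Submodule.span ℂ {Beam.linearFn ℓ 0 1} ∧
      Module.finrank ℂ (Beam.eigenspace A 0) = 1) ∧
    (S = .ends .free .flexible →
      Beam.eigenspace A 0 = Submodule.span ℂ {Beam.linearFn ℓ ℓ (-1)} ∧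
      Module.finrank ℂ (Beam.eigenspace A 0) = 1) ∧
    (S = .ends .free .free →
      Beam.eigenspace A 0 = Submodule.span ℂ {Beam.linearFn ℓ 1 0, Beam.linearFn ℓ 0 1} ∧
      Module.finrank ℂ (Beam.eigenspace A 0) = 2) ∧
    (S = .addI →
      Beam.eigenspace A 0 = Submodule.span ℂ {Beam.linearFn ℓ 1 0} ∧
      Module.finrank ℂ (Beam.eigenspace A 0) = 1) := by

  obtain ⟨R, hR⟩ := Beam.exists_isInverseAddOne hA.selfAdjoint hA.positive
  have hc := hA.isCompactOperator hℓ hR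
  obtain ⟨ψ, a, hψ, h0, hmono, ht⟩ := Beam.exists_monotone_eigenbasis hA.selfAdjoint hA.positive
    hR hc (Beam.not_finiteDimensional_L2 hℓ)
  have hs := Beam.spectrum_eq_pointSpectrum hR hc
  have hp := Beam.pointSpectrum_eq_range hA.selfAdjoint hψ ht
  refine ⟨⟨hs, fun z hz => ?_⟩,
    fun z => (Beam.finrank_eigenspace hA.selfAdjoint hψ ht z).1,
    ⟨ψ, a, hψ, h0, hmono, ht, hp, fun z => ⟨Beam.finite_setOf_eigenvalue_eq ht z,
      (Beam.finrank_eigenspace hA.selfAdjoint hψ ht z).2⟩⟩,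
    hA.zero_mem_pointSpectrum_iff hℓ, ?_, ?_, ?_, ?_⟩
  · rw [hs, hp] at hz
    obtain ⟨n, rfl⟩ := hz
    exact ⟨a n, h0 n, rfl⟩
  · rintro rfl
    rw [hA.ker_flexible_free hℓ]
    exact ⟨rfl, finrank_span_singleton (Beam.linearFn_ne_zero hℓ (by simp))⟩
  · rintro rfl
    rw [hA.ker_free_flexible hℓ]
    exact ⟨rfl, finrank_span_singleton (Beam.linearFn_ne_zero hℓ (by simp))⟩
  · rintro rfl
    rw [hA.ker_free_free hℓ]
    exact ⟨rfl, Beam.finrank_span_linearFn_pair hℓ⟩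
  · rintro rfl
    rw [hA.ker_addI hℓ]
    exact ⟨rfl, finrank_span_singleton (Beam.linearFn_ne_zero hℓ (by simp))⟩
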